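/- **Definitions.** Let $[m]=\{1,\dots,m\}$. A *couple* $ij|C$ on $[m]$ consists of a two-element set $ij=\{i,j\}\subseteq[m]$ and a set $C\subseteq[m]\setminus ij$; we write $ij$ for $ij|\emptyset$. A (conditional independence) *relation* on $[m]$ is a set of couples. Write $iC=\{i\}\cup C$, and let $\mathit{PD}_m$ be the set of real symmetric positive definite $m\times m$ matrices. For a relation $\mathcal L$ put $$V_{pd}(\mathcal L)=\{\Sigma\in \mathit{PD}_m:\ \det(\Sigma_{iC,jC})=0\ \text{ for all } ij|C\in\mathcal L\},$$ and for $W\subseteq \mathit{PD}_m$ let $\mathcal L(W)$ be the set of all couples $ij|C$ with $\det(\Sigma_{iC,jC})=0$ for all $\Sigma\in W$. A relation $\mathcal L$ is *complete* if $\mathcal L=\mathcal L(V_{pd}(\mathcal L))$, and *representable* if $\mathcal L=\mathcal L(\{\Sigma\})$ for some $\Sigma\in \mathit{PD}_m$. Permutations $\sigma$ of $[m]$ act on relations by $\sigma\mathcal L=\{\sigma(i)\sigma(j)|\sigma(C): ij|C\in\mathcal L\}$; two relations are *equivalent* if some permutation turns one into the other. A *minimal representable decomposition* of $V_{pd}(\mathcal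 L)$ is an equality $V_{pd}(\mathcal L)=V_{pd}(\mathcal K_1)\cup\dots\cup V_{pd}(\mathcal K_k)$ with representable relations $\mathcal K_1,\dots,\mathcal K_k$ such that $\mathcal K_a\not\subseteq\mathcal K_b$ for all $a\ne b$. **Theorem.** There are exactly 101 equivalence classes of complete relations on $[4]$. Every representable relation on $[4]$ is complete; 53 of the 101 classes consist of representable relations, and the other 48 of complete relations that are not representable. More precisely: 1. The relations $\mathcal L_1,\dots,\mathcal L_{53}$ of Table 1 are pairwise inequivalent, and a relation on $[4]$ is representable if and only if it is equivalent to one of them. 2. For $54\le n\le 101$ let $\mathcal L_n$ be the intersection of the relations listed for $n$ in Table 2. Then $\mathcal L_{54},\dots,\mathcal L_{101}$ are pairwise inequivalent, and a relation on $[4]$ is complete and not representable if and only if it is equivalent to one of them. 3. For $54\le n\le 101$ the relations listed for $n$ in Table 2 yield a minimal representable decomposition of $V_{pd}(\mathcal L_n)$. **Table 1.** Here $ij|{\ast}$ stands for the four couples $ij|C$ with $C\subseteq[4]\setminus ij$, and a set $C=\{k\}$ or $\{k,l\}$ is written $k$ or $kl$. - $\mathcal L_{1}=\{12|{\ast},13|{\ast},14|{\ast},23|{\ast},24|{\ast},34|{\ast}\}$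 - $\mathcal L_{2}=\{13|{\ast},14|{\ast},23|{\ast},24|{\ast},34|{\ast}\}$ - $\mathcal L_{3}=\{14|{\ast},24|{\ast},34|{\ast},23|1,23|14\}$ - $\mathcal L_{4}=\{13|{\ast},14|{\ast},23|{\ast},24|{\ast}\}$ - $\mathcal L_{5}=\{14|{\ast},24|{\ast},34|{\ast}\}$ - $\mathcal L_{6}=\{23|1,23|14,24|1,24|13,34|1,34|12\}$ - $\mathcal L_{7}=\{14|2,14|23,23|1,23|14,34|1,34|2,34|12\}$ - $\mathcal L_{8}=\{23|1,23|14,34|1,34|12\}$ - $\mathcal L_{9}=\{23|1,23|14,24|3,34|1,34|12\}$ - $\mathcal L_{10}=\{12,12|3,23,23|1,23|14,34|1,34|12\}$ - $\mathcal L_{11}=\{23|1,23|14,24,34|1,34|12\}$ - $\mathcal L_{12}=\{14|23,23|14\}$ - $\mathcal L_{13}=\{12,14|23,23|14\}$ - $\mathcal L_{14}=\{14,14|23,23|14\}$ - $\mathcal L_{15}=\{14,14|23,23,23|14\}$ - $\mathcal L_{16}=\{23|14\}$ - $\mathcal L_{17}=\{12|3,23|14\}$ - $\mathcal L_{18}=\{14|2,23|14\}$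 - $\mathcal L_{19}=\{12|3,14|2,23|14\}$ - $\mathcal L_{20}=\{14|2,14|3,23|14\}$ - $\mathcal L_{21}=\{13|2,23|14,24|3\}$ - $\mathcal L_{22}=\{12,23|14\}$ - $\mathcal L_{23}=\{12,14|3,23|14\}$ - $\mathcal L_{24}=\{12,23|14,24|3\}$ - $\mathcal L_{25}=\{12,23|14,34|2\}$ - $\mathcal L_{26}=\{14,23|14\}$ - $\mathcal L_{27}=\{12|3,14,23|14\}$ - $\mathcal L_{28}=\{13|2,14,23|14,24|3\}$ - $\mathcal L_{29}=\{23,23|14\}$ - $\mathcal L_{30}=\{14|2,23,23|14\}$ - $\mathcal L_{31}=\{12|3\}$ - $\mathcal L_{32}=\{12|3,12|4\}$ - $\mathcal L_{33}=\{12|3,13|4\}$ - $\mathcal L_{34}=\{12|3,14|2,23|4\}$ - $\mathcal L_{35}=\{12|3,34|1\}$ - $\mathcal L_{36}=\{12|3,12|4,34|1\}$ - $\mathcal L_{37}=\{12|3,12|4,34|1,34|2\}$ - $\mathcal L_{38}=\{14|{\ast},24|{\ast},34|{\ast},23,23|4\}$ - $\mathcal L_{39}=\{23,23|4,24,24|3,34,34|2\}$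 - $\mathcal L_{40}=\{14,14|3,23,23|4,34,34|1,34|2\}$ - $\mathcal L_{41}=\{23,23|4,34,34|2\}$ - $\mathcal L_{42}=\{23,23|4,24|1,34,34|2\}$ - $\mathcal L_{43}=\{23,23|4,24|13,34,34|2\}$ - $\mathcal L_{44}=\{14,23\}$ - $\mathcal L_{45}=\{12|34,14,23\}$ - $\mathcal L_{46}=\{14,14|23,23\}$ - $\mathcal L_{47}=\{23\}$ - $\mathcal L_{48}=\{12|4,23\}$ - $\mathcal L_{49}=\{14|3,23\}$ - $\mathcal L_{50}=\{12|4,14|3,23\}$ - $\mathcal L_{51}=\{14|2,14|3,23\}$ - $\mathcal L_{52}=\{13|4,23,24|1\}$ - $\mathcal L_{53}=\emptyset$ **Table 2.** Permutations are written in cycle notation, so $(234)$ maps $2\mapsto3\mapsto4\mapsto2$, and $\sigma\mathcal L_k$ is the image of $\mathcal L_k$ under $\sigma$. - $\mathcal L_{54}$: $\mathcal L_{2}$, $(234)\mathcal L_{2}$ - $\mathcal L_{55}$: $(34)\mathcal L_{3}$, $(234)\mathcal L_{3}$ - $\mathcal L_{56}$: $\mathcal L_{2}$, $(234)\mathcal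 L_{3}$ - $\mathcal L_{57}$: $\mathcal L_{2}$, $(234)\mathcal L_{2}$, $(24)\mathcal L_{2}$ - $\mathcal L_{58}$: $\mathcal L_{3}$, $(1243)\mathcal L_{3}$, $(234)\mathcal L_{4}$ - $\mathcal L_{59}$: $\mathcal L_{3}$, $(234)\mathcal L_{4}$ - $\mathcal L_{60}$: $\mathcal L_{2}$, $(234)\mathcal L_{4}$ - $\mathcal L_{61}$: $(34)\mathcal L_{5}$, $(24)\mathcal L_{7}$ - $\mathcal L_{62}$: $(34)\mathcal L_{5}$, $\mathcal L_{10}$ - $\mathcal L_{63}$: $(234)\mathcal L_{3}$, $(234)\mathcal L_{4}$, $(34)\mathcal L_{5}$ - $\mathcal L_{64}$: $(234)\mathcal L_{3}$, $(234)\mathcal L_{4}$, $(143)\mathcal L_{38}$ - $\mathcal L_{65}$: $\mathcal L_{3}$, $(234)\mathcal L_{3}$, $(34)\mathcal L_{38}$ - $\mathcal L_{66}$: $(234)\mathcal L_{3}$, $(34)\mathcal L_{38}$ - $\mathcal L_{67}$: $(234)\mathcal L_{4}$, $(34)\mathcal L_{5}$ - $\mathcal L_{68}$: $\mathcal L_{7}$,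 $(1243)\mathcal L_{7}$ - $\mathcal L_{69}$: $\mathcal L_{4}$, $\mathcal L_{7}$ - $\mathcal L_{70}$: $\mathcal L_{3}$, $(14)(23)\mathcal L_{3}$, $\mathcal L_{4}$, $(234)\mathcal L_{4}$ - $\mathcal L_{71}$: $\mathcal L_{3}$, $\mathcal L_{4}$, $(234)\mathcal L_{4}$ - $\mathcal L_{72}$: $\mathcal L_{4}$, $(234)\mathcal L_{4}$ - $\mathcal L_{73}$: $\mathcal L_{8}$, $(243)\mathcal L_{8}$ - $\mathcal L_{74}$: $\mathcal L_{7}$, $(243)\mathcal L_{10}$ - $\mathcal L_{75}$: $(234)\mathcal L_{5}$, $(13)(24)\mathcal L_{7}$, $(142)\mathcal L_{9}$ - $\mathcal L_{76}$: $(34)\mathcal L_{5}$, $(234)\mathcal L_{5}$, $(24)\mathcal L_{7}$, $(243)\mathcal L_{7}$ - $\mathcal L_{77}$: $(234)\mathcal L_{5}$, $\mathcal L_{10}$, $(1423)\mathcal L_{43}$ - $\mathcal L_{78}$: $(234)\mathcal L_{5}$, $(1432)\mathcal L_{10}$, $(142)\mathcal L_{11}$ - $\mathcal L_{79}$: $(14)(23)\mathcal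 L_{3}$, $(234)\mathcal L_{4}$, $(234)\mathcal L_{5}$, $(143)\mathcal L_{38}$ - $\mathcal L_{80}$: $(243)\mathcal L_{10}$, $(1432)\mathcal L_{10}$ - $\mathcal L_{81}$: $(24)\mathcal L_{10}$, $(243)\mathcal L_{10}$ - $\mathcal L_{82}$: $(234)\mathcal L_{4}$, $(243)\mathcal L_{10}$ - $\mathcal L_{83}$: $(34)\mathcal L_{5}$, $(234)\mathcal L_{5}$, $\mathcal L_{10}$, $(23)\mathcal L_{10}$ - $\mathcal L_{84}$: $\mathcal L_{4}$, $(234)\mathcal L_{4}$, $(34)\mathcal L_{5}$, $(234)\mathcal L_{5}$ - $\mathcal L_{85}$: $(1243)\mathcal L_{3}$, $\mathcal L_{4}$, $(234)\mathcal L_{4}$, $(13)(24)\mathcal L_{38}$ - $\mathcal L_{86}$: $(34)\mathcal L_{38}$, $(234)\mathcal L_{38}$ - $\mathcal L_{87}$: $\mathcal L_{2}$, $(234)\mathcal L_{38}$ - $\mathcal L_{88}$: $(234)\mathcal L_{4}$, $\mathcal L_{38}$, $(1243)\mathcal L_{38}$ - $\mathcal L_{89}$: $(234)\mathcal L_{4}$,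 $\mathcal L_{38}$ - $\mathcal L_{90}$: $(34)\mathcal L_{5}$, $(24)\mathcal L_{40}$ - $\mathcal L_{91}$: $(34)\mathcal L_{5}$, $(14)(23)\mathcal L_{10}$ - $\mathcal L_{92}$: $(234)\mathcal L_{4}$, $(34)\mathcal L_{5}$, $(234)\mathcal L_{38}$ - $\mathcal L_{93}$: $(34)\mathcal L_{3}$, $\mathcal L_{38}$, $(234)\mathcal L_{38}$ - $\mathcal L_{94}$: $\mathcal L_{40}$, $(1243)\mathcal L_{40}$ - $\mathcal L_{95}$: $\mathcal L_{4}$, $\mathcal L_{40}$ - $\mathcal L_{96}$: $\mathcal L_{4}$, $(234)\mathcal L_{4}$, $\mathcal L_{38}$, $(14)(23)\mathcal L_{38}$ - $\mathcal L_{97}$: $\mathcal L_{4}$, $(234)\mathcal L_{4}$, $\mathcal L_{38}$ - $\mathcal L_{98}$: $\mathcal L_{41}$, $(243)\mathcal L_{41}$ - $\mathcal L_{99}$: $(134)\mathcal L_{10}$, $\mathcal L_{40}$ - $\mathcal L_{100}$: $(234)\mathcal L_{5}$, $(13)(24)\mathcal L_{40}$, $(142)\mathcal L_{42}$ - $\mathcal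 L_{101}$: $(34)\mathcal L_{5}$, $(234)\mathcal L_{5}$, $(24)\mathcal L_{40}$, $(243)\mathcal L_{40}$ -/

import Mathlib

/-! Gaussian conditional independence relations on the ground set `Fin m`, which stands for
`{1, …, m}`. -/

/-- A conditional independence couple `ij|C`, stored as `({i, j}, C)`: a two-element set `{i, j}`
of indices and a conditioning set `C` that is disjoint from it. -/
abbrev CICouple (m : ℕ) : Type :=
  {q : Finset (Fin m) × Finset (Fin m) // q.1.card = 2 ∧ Disjoint q.1 q.2}

/-- A conditional independence relation: a set of couples. -/
abbrev CIRelation (m : ℕ) : Type := Finset (CICouple m)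

/-- The determinant of the submatrix of `S` with rows `iC` and columns `jC`. Rows and columns are
both indexed by `Option C`, where `none` stands for `i`, respectively `j`. -/
noncomputable def ciDet {m : ℕ} (S : Matrix (Fin m) (Fin m) ℝ) (i j : Fin m)
    (C : Finset (Fin m)) : ℝ :=
  (S.submatrix (fun o : Option C => o.elim i Subtype.val)
    (fun o : Option C => o.elim j Subtype.val)).det

/-- The couple `ij|C` holds for `S`: the determinant with rows `iC` and columns `jC` vanishes. Both
orders of the pair are asked for; for a symmetric matrix the two conditions agree. -/
def CoupleHolds {m : ℕ} (S : Matrix (Fin m) (Fin m) ℝ) (q : CICouple m) : Prop :=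
  ∀ i j : Fin m, q.1.1 = {i, j} → ciDet S i j q.1.2 = 0

/-- The model of a relation: all positive definite matrices for which its couples hold. -/
def Vpd {m : ℕ} (L : CIRelation m) : Set (Matrix (Fin m) (Fin m) ℝ) :=
  {S | S.PosDef ∧ ∀ q ∈ L, CoupleHolds S q}

open Classical in
/-- The relation of a set of matrices: all couples that hold for each of its members. -/
noncomputable def relationOf {m : ℕ} (W : Set (Matrix (Fin m) (Fin m) ℝ)) : CIRelation m :=
  Finset.univ.filter fun q => ∀ S ∈ W, CoupleHolds S q

/-- A relation is complete if it consists of all couples that hold throughout its model. -/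
def IsCompleteRelation {m : ℕ} (L : CIRelation m) : Prop :=
  L = relationOf (Vpd L)

/-- A relation is representable if it consists of exactly the couples that hold for some single
positive definite matrix. -/
def IsRepresentable {m : ℕ} (L : CIRelation m) : Prop :=
  ∃ S : Matrix (Fin m) (Fin m) ℝ, S.PosDef ∧ ∀ q, CoupleHolds S q ↔ q ∈ L

/-- `Ls` lists a minimal representable decomposition of the model of `L`: the model is the union
of the models of the representable relations in `Ls`, none of which contains another one. -/
def IsMinimalRepresentableDecomposition {m : ℕ} (L : CIRelation m)
    (Ls : List (CIRelation m)) : Prop :=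
  (∀ K ∈ Ls, IsRepresentable K) ∧
  Vpd L = ⋃ K ∈ Ls, Vpd K ∧
  Ls.Pairwise fun K K' => ¬ K ⊆ K' ∧ ¬ K' ⊆ K

/-- A permutation of the indices acts on couples. -/
def permuteCouple {m : ℕ} (σ : Equiv.Perm (Fin m)) (q : CICouple m) : CICouple m :=
  ⟨(q.1.1.map σ.toEmbedding, q.1.2.map σ.toEmbedding), by
    rw [Finset.card_map]; exact q.2.1, (Finset.disjoint_map _).2 q.2.2⟩

/-- A permutation of the indices acts on relations. -/
def permute {m : ℕ} (σ : Equiv.Perm (Fin m)) (L : CIRelation m) : CIRelation m :=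
  L.image (permuteCouple σ)

/-- Two relations are equivalent if some permutation of the indices turns one into the other. -/
def CIEquivalent {m : ℕ} (K L : CIRelation m) : Prop :=
  ∃ σ : Equiv.Perm (Fin m), permute σ K = L

theorem permute_one {m : ℕ} (L : CIRelation m) : permute 1 L = L := by
  have h : permuteCouple (1 : Equiv.Perm (Fin m)) = id := by
    funext q
    apply Subtype.ext
    apply Prod.ext <;> ext x <;> simp only [permuteCouple, Finset.mem_map_equiv, id] <;>
      exact Iff.rfl
  simp [permute, h]

theorem permute_mul {m : ℕ} (σ τ : Equiv.Perm (Fin m)) (L : CIRelation m) :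
    permute (σ * τ) L = permute σ (permute τ L) := by
  have h : permuteCouple (σ * τ) = permuteCouple σ ∘ permuteCouple τ := by
    funext q
    apply Subtype.ext
    apply Prod.ext <;> ext x <;> simp only [permuteCouple, Finset.mem_map_equiv, Function.comp] <;>
      exact Iff.rfl
  simp [permute, h, Finset.image_image]

/-- Equivalence of relations as an equivalence relation. -/
def ciSetoid (m : ℕ) : Setoid (CIRelation m) where
  r := CIEquivalent
  iseqv :=
    { refl := fun L => ⟨1, permute_one L⟩
      symm := by
        rintro K L ⟨σ, rfl⟩
        exact ⟨σ⁻¹, by rw [← permute_mul, inv_mul_cancel, permute_one]⟩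
      trans := by
        rintro K L M ⟨σ, rfl⟩ ⟨τ, rfl⟩
        exact ⟨τ * σ, permute_mul τ σ K⟩ }

/-- The number of equivalence classes of the relations on `m` indices with property `P`. -/
noncomputable def numClasses (m : ℕ) (P : CIRelation m → Prop) : ℕ :=
  {c : Quotient (ciSetoid m) | ∃ L, P L ∧ Quotient.mk (ciSetoid m) L = c}.ncard

/-! The tables. The indices `1, 2, 3, 4` are the elements `0, 1, 2, 3` of `Fin 4`, and a set of at
most two indices is written as the number with these decimal digits (`0` for the empty set). -/

/-- The set of indices written as the digits of `n`. -/
def digitSet (n : ℕ) : Finset (Fin 4) :=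
  Finset.univ.filter fun k => (k : ℕ) + 1 = n % 10 ∨ (k : ℕ) + 1 = n / 10

/-- `rel stars couples` consists of the couples `ij|C` with `(ij, C)` in the list `couples`, and of
the couples `ij|C` for every conditioning set `C` (written `ij|∗`) when `ij` is in `stars`. -/
def rel (stars : List ℕ) (couples : List (ℕ × ℕ)) : CIRelation 4 :=
  Finset.univ.filter fun q =>
    (∃ p ∈ stars, q.1.1 = digitSet p) ∨
    (∃ a ∈ couples, q.1.1 = digitSet a.1 ∧ q.1.2 = digitSet a.2)

/-- The permutation of the indices with the given disjoint cycles, in the labels `1, 2, 3, 4`. -/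
def cyc (cs : List (List ℕ)) : Equiv.Perm (Fin 4) :=
  (cs.map fun c => (c.map fun n => Fin.ofNat 4 (n - 1)).formPerm).prod

/-- A listed component: a relation, the number of the relation in `representableTable` (counted
from `1`) to which it is equivalent, and a permutation that turns that one into this one. -/
structure Component where
  relation : CIRelation 4
  label : ℕ
  perm : Equiv.Perm (Fin 4)

/-- The intersection of the components of a table entry. -/
def intersection (t : List Component) : CIRelation 4 :=
  Finset.univ.filter fun q => ∀ r ∈ t, q ∈ r.relation

/-- Representatives `L₁, …, L₅₃` of the representable relations. -/
def representableTable : List (CIRelation 4) :=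
  [rel [12, 13, 14, 23, 24, 34] [],
   rel [13, 14, 23, 24, 34] [],
   rel [14, 24, 34] [(23, 1), (23, 14)],
   rel [13, 14, 23, 24] [],
   rel [14, 24, 34] [],
   rel [] [(23, 1), (23, 14), (24, 1), (24, 13), (34, 1), (34, 12)],
   rel [] [(14, 2), (14, 23), (23, 1), (23, 14), (34, 1), (34, 2), (34, 12)],
   rel [] [(23, 1), (23, 14), (34, 1), (34, 12)],
   rel [] [(23, 1), (23, 14), (24, 3), (34, 1), (34, 12)],
   rel [] [(12, 0), (12, 3), (23, 0), (23, 1), (23, 14), (34, 1), (34, 12)],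
   rel [] [(23, 1), (23, 14), (24, 0), (34, 1), (34, 12)],
   rel [] [(14, 23), (23, 14)],
   rel [] [(12, 0), (14, 23), (23, 14)],
   rel [] [(14, 0), (14, 23), (23, 14)],
   rel [] [(14, 0), (14, 23), (23, 0), (23, 14)],
   rel [] [(23, 14)],
   rel [] [(12, 3), (23, 14)],
   rel [] [(14, 2), (23, 14)],
   rel [] [(12, 3), (14, 2), (23, 14)],
   rel [] [(14, 2), (14, 3), (23, 14)],
   rel [] [(13, 2), (23, 14), (24, 3)],
   rel [] [(12, 0), (23, 14)],
   rel [] [(12, 0), (14, 3), (23, 14)],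
   rel [] [(12, 0), (23, 14), (24, 3)],
   rel [] [(12, 0), (23, 14), (34, 2)],
   rel [] [(14, 0), (23, 14)],
   rel [] [(12, 3), (14, 0), (23, 14)],
   rel [] [(13, 2), (14, 0), (23, 14), (24, 3)],
   rel [] [(23, 0), (23, 14)],
   rel [] [(14, 2), (23, 0), (23, 14)],
   rel [] [(12, 3)],
   rel [] [(12, 3), (12, 4)],
   rel [] [(12, 3), (13, 4)],
   rel [] [(12, 3), (14, 2), (23, 4)],
   rel [] [(12, 3), (34, 1)],
   rel [] [(12, 3), (12, 4), (34, 1)],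
   rel [] [(12, 3), (12, 4), (34, 1), (34, 2)],
   rel [14, 24, 34] [(23, 0), (23, 4)],
   rel [] [(23, 0), (23, 4), (24, 0), (24, 3), (34, 0), (34, 2)],
   rel [] [(14, 0), (14, 3), (23, 0), (23, 4), (34, 0), (34, 1), (34, 2)],
   rel [] [(23, 0), (23, 4), (34, 0), (34, 2)],
   rel [] [(23, 0), (23, 4), (24, 1), (34, 0), (34, 2)],
   rel [] [(23, 0), (23, 4), (24, 13), (34, 0), (34, 2)],
   rel [] [(14, 0), (23, 0)],
   rel [] [(12, 34), (14, 0), (23, 0)],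
   rel [] [(14, 0), (14, 23), (23, 0)],
   rel [] [(23, 0)],
   rel [] [(12, 4), (23, 0)],
   rel [] [(14, 3), (23, 0)],
   rel [] [(12, 4), (14, 3), (23, 0)],
   rel [] [(14, 2), (14, 3), (23, 0)],
   rel [] [(13, 4), (23, 0), (24, 1)],
   rel [] []]

/-- The representable decompositions of the complete, non-representable relations
`L₅₄, …, L₁₀₁`. -/
def completeTable : List (List Component) :=
  [[⟨rel [13, 14, 23, 24, 34] [], 2, cyc []⟩,
    ⟨rel [12, 14, 23, 24, 34] [], 2, cyc [[2, 3, 4]]⟩],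
   [⟨rel [13, 23, 34] [(24, 1), (24, 13)], 3, cyc [[3, 4]]⟩,
    ⟨rel [12, 23, 24] [(34, 1), (34, 12)], 3, cyc [[2, 3, 4]]⟩],
   [⟨rel [13, 14, 23, 24, 34] [], 2, cyc []⟩,
    ⟨rel [12, 23, 24] [(34, 1), (34, 12)], 3, cyc [[2, 3, 4]]⟩],
   [⟨rel [13, 14, 23, 24, 34] [], 2, cyc []⟩,
    ⟨rel [12, 14, 23, 24, 34] [], 2, cyc [[2, 3, 4]]⟩,
    ⟨rel [12, 13, 23, 24, 34] [], 2, cyc [[2, 4]]⟩],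
   [⟨rel [14, 24, 34] [(23, 1), (23, 14)], 3, cyc []⟩,
    ⟨rel [13, 23, 34] [(14, 2), (14, 23)], 3, cyc [[1, 2, 4, 3]]⟩,
    ⟨rel [12, 14, 23, 34] [], 4, cyc [[2, 3, 4]]⟩],
   [⟨rel [14, 24, 34] [(23, 1), (23, 14)], 3, cyc []⟩,
    ⟨rel [12, 14, 23, 34] [], 4, cyc [[2, 3, 4]]⟩],
   [⟨rel [13, 14, 23, 24, 34] [], 2, cyc []⟩,
    ⟨rel [12, 14, 23, 34] [], 4, cyc [[2, 3, 4]]⟩],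
   [⟨rel [13, 23, 34] [], 5, cyc [[3, 4]]⟩,
    ⟨rel [] [(12, 4), (12, 34), (23, 1), (23, 4), (23, 14), (34, 1), (34, 12)], 7, cyc [[2, 4]]⟩],
   [⟨rel [13, 23, 34] [], 5, cyc [[3, 4]]⟩,
    ⟨rel [] [(12, 0), (12, 3), (23, 0), (23, 1), (23, 14), (34, 1), (34, 12)], 10, cyc []⟩],
   [⟨rel [12, 23, 24] [(34, 1), (34, 12)], 3, cyc [[2, 3, 4]]⟩,
    ⟨rel [12, 14, 23, 34] [], 4, cyc [[2, 3, 4]]⟩,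
    ⟨rel [13, 23, 34] [], 5, cyc [[3, 4]]⟩],
   [⟨rel [12, 23, 24] [(34, 1), (34, 12)], 3, cyc [[2, 3, 4]]⟩,
    ⟨rel [12, 14, 23, 34] [], 4, cyc [[2, 3, 4]]⟩,
    ⟨rel [13, 23, 34] [(12, 0), (12, 3)], 38, cyc [[1, 4, 3]]⟩],
   [⟨rel [14, 24, 34] [(23, 1), (23, 14)], 3, cyc []⟩,
    ⟨rel [12, 23, 24] [(34, 1), (34, 12)], 3, cyc [[2, 3, 4]]⟩,
    ⟨rel [13, 23, 34] [(24, 0), (24, 3)], 38, cyc [[3, 4]]⟩],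
   [⟨rel [12, 23, 24] [(34, 1), (34, 12)], 3, cyc [[2, 3, 4]]⟩,
    ⟨rel [13, 23, 34] [(24, 0), (24, 3)], 38, cyc [[3, 4]]⟩],
   [⟨rel [12, 14, 23, 34] [], 4, cyc [[2, 3, 4]]⟩,
    ⟨rel [13, 23, 34] [], 5, cyc [[3, 4]]⟩],
   [⟨rel [] [(14, 2), (14, 23), (23, 1), (23, 14), (34, 1), (34, 2), (34, 12)], 7, cyc []⟩,
    ⟨rel [] [(13, 2), (13, 4), (13, 24), (14, 2), (14, 23), (23, 4), (23, 14)], 7, cyc [[1, 2, 4, 3]]⟩],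
   [⟨rel [13, 14, 23, 24] [], 4, cyc []⟩,
    ⟨rel [] [(14, 2), (14, 23), (23, 1), (23, 14), (34, 1), (34, 2), (34, 12)], 7, cyc []⟩],
   [⟨rel [14, 24, 34] [(23, 1), (23, 14)], 3, cyc []⟩,
    ⟨rel [12, 13, 14] [(23, 4), (23, 14)], 3, cyc [[1, 4], [2, 3]]⟩,
    ⟨rel [13, 14, 23, 24] [], 4, cyc []⟩,
    ⟨rel [12, 14, 23, 34] [], 4, cyc [[2, 3, 4]]⟩],
   [⟨rel [14, 24, 34] [(23, 1), (23, 14)], 3, cyc []⟩,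
    ⟨rel [13, 14, 23, 24] [], 4, cyc []⟩,
    ⟨rel [12, 14, 23, 34] [], 4, cyc [[2, 3, 4]]⟩],
   [⟨rel [13, 14, 23, 24] [], 4, cyc []⟩,
    ⟨rel [12, 14, 23, 34] [], 4, cyc [[2, 3, 4]]⟩],
   [⟨rel [] [(23, 1), (23, 14), (34, 1), (34, 12)], 8, cyc []⟩,
    ⟨rel [] [(23, 1), (23, 14), (24, 1), (24, 13)], 8, cyc [[2, 4, 3]]⟩],
   [⟨rel [] [(14, 2), (14, 23), (23, 1), (23, 14), (34, 1), (34, 2), (34, 12)], 7, cyc []⟩,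
    ⟨rel [] [(14, 0), (14, 2), (23, 1), (23, 14), (24, 0), (24, 1), (24, 13)], 10, cyc [[2, 4, 3]]⟩],
   [⟨rel [12, 23, 24] [], 5, cyc [[2, 3, 4]]⟩,
    ⟨rel [] [(12, 3), (12, 4), (12, 34), (14, 3), (14, 23), (23, 4), (23, 14)], 7, cyc [[1, 3], [2, 4]]⟩,
    ⟨rel [] [(12, 3), (13, 4), (13, 24), (23, 4), (23, 14)], 9, cyc [[1, 4, 2]]⟩],
   [⟨rel [13, 23, 34] [], 5, cyc [[3, 4]]⟩,
    ⟨rel [12, 23, 24] [], 5, cyc [[2, 3, 4]]⟩,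
    ⟨rel [] [(12, 4), (12, 34), (23, 1), (23, 4), (23, 14), (34, 1), (34, 12)], 7, cyc [[2, 4]]⟩,
    ⟨rel [] [(13, 4), (13, 24), (23, 1), (23, 4), (23, 14), (24, 1), (24, 13)], 7, cyc [[2, 4, 3]]⟩],
   [⟨rel [12, 23, 24] [], 5, cyc [[2, 3, 4]]⟩,
    ⟨rel [] [(12, 0), (12, 3), (23, 0), (23, 1), (23, 14), (34, 1), (34, 12)], 10, cyc []⟩,
    ⟨rel [] [(12, 0), (12, 3), (13, 0), (13, 2), (23, 14)], 43, cyc [[1, 4, 2, 3]]⟩],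
   [⟨rel [12, 23, 24] [], 5, cyc [[2, 3, 4]]⟩,
    ⟨rel [] [(12, 0), (12, 4), (12, 34), (14, 0), (14, 2), (23, 4), (23, 14)], 10, cyc [[1, 4, 3, 2]]⟩,
    ⟨rel [] [(12, 0), (13, 4), (13, 24), (23, 4), (23, 14)], 11, cyc [[1, 4, 2]]⟩],
   [⟨rel [12, 13, 14] [(23, 4), (23, 14)], 3, cyc [[1, 4], [2, 3]]⟩,
    ⟨rel [12, 14, 23, 34] [], 4, cyc [[2, 3, 4]]⟩,
    ⟨rel [12, 23, 24] [], 5, cyc [[2, 3, 4]]⟩,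
    ⟨rel [13, 23, 34] [(12, 0), (12, 3)], 38, cyc [[1, 4, 3]]⟩],
   [⟨rel [] [(14, 0), (14, 2), (23, 1), (23, 14), (24, 0), (24, 1), (24, 13)], 10, cyc [[2, 4, 3]]⟩,
    ⟨rel [] [(12, 0), (12, 4), (12, 34), (14, 0), (14, 2), (23, 4), (23, 14)], 10, cyc [[1, 4, 3, 2]]⟩],
   [⟨rel [] [(14, 0), (14, 3), (23, 1), (23, 14), (34, 0), (34, 1), (34, 12)], 10, cyc [[2, 4]]⟩,
    ⟨rel [] [(14, 0), (14, 2), (23, 1), (23, 14), (24, 0), (24, 1), (24, 13)], 10, cyc [[2, 4, 3]]⟩],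
   [⟨rel [12, 14, 23, 34] [], 4, cyc [[2, 3, 4]]⟩,
    ⟨rel [] [(14, 0), (14, 2), (23, 1), (23, 14), (24, 0), (24, 1), (24, 13)], 10, cyc [[2, 4, 3]]⟩],
   [⟨rel [13, 23, 34] [], 5, cyc [[3, 4]]⟩,
    ⟨rel [12, 23, 24] [], 5, cyc [[2, 3, 4]]⟩,
    ⟨rel [] [(12, 0), (12, 3), (23, 0), (23, 1), (23, 14), (34, 1), (34, 12)], 10, cyc []⟩,
    ⟨rel [] [(13, 0), (13, 2), (23, 0), (23, 1), (23, 14), (24, 1), (24, 13)], 10, cyc [[2, 3]]⟩],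
   [⟨rel [13, 14, 23, 24] [], 4, cyc []⟩,
    ⟨rel [12, 14, 23, 34] [], 4, cyc [[2, 3, 4]]⟩,
    ⟨rel [13, 23, 34] [], 5, cyc [[3, 4]]⟩,
    ⟨rel [12, 23, 24] [], 5, cyc [[2, 3, 4]]⟩],
   [⟨rel [13, 23, 34] [(14, 2), (14, 23)], 3, cyc [[1, 2, 4, 3]]⟩,
    ⟨rel [13, 14, 23, 24] [], 4, cyc []⟩,
    ⟨rel [12, 14, 23, 34] [], 4, cyc [[2, 3, 4]]⟩,
    ⟨rel [12, 23, 24] [(14, 0), (14, 2)], 38, cyc [[1, 3], [2, 4]]⟩],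
   [⟨rel [13, 23, 34] [(24, 0), (24, 3)], 38, cyc [[3, 4]]⟩,
    ⟨rel [12, 23, 24] [(34, 0), (34, 2)], 38, cyc [[2, 3, 4]]⟩],
   [⟨rel [13, 14, 23, 24, 34] [], 2, cyc []⟩,
    ⟨rel [12, 23, 24] [(34, 0), (34, 2)], 38, cyc [[2, 3, 4]]⟩],
   [⟨rel [12, 14, 23, 34] [], 4, cyc [[2, 3, 4]]⟩,
    ⟨rel [14, 24, 34] [(23, 0), (23, 4)], 38, cyc []⟩,
    ⟨rel [13, 23, 34] [(14, 0), (14, 3)], 38, cyc [[1, 2, 4, 3]]⟩],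
   [⟨rel [12, 14, 23, 34] [], 4, cyc [[2, 3, 4]]⟩,
    ⟨rel [14, 24, 34] [(23, 0), (23, 4)], 38, cyc []⟩],
   [⟨rel [13, 23, 34] [], 5, cyc [[3, 4]]⟩,
    ⟨rel [] [(12, 0), (12, 3), (23, 0), (23, 1), (23, 4), (34, 0), (34, 2)], 40, cyc [[2, 4]]⟩],
   [⟨rel [13, 23, 34] [], 5, cyc [[3, 4]]⟩,
    ⟨rel [] [(12, 4), (12, 34), (23, 0), (23, 4), (23, 14), (34, 0), (34, 2)], 10, cyc [[1, 4], [2, 3]]⟩],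
   [⟨rel [12, 14, 23, 34] [], 4, cyc [[2, 3, 4]]⟩,
    ⟨rel [13, 23, 34] [], 5, cyc [[3, 4]]⟩,
    ⟨rel [12, 23, 24] [(34, 0), (34, 2)], 38, cyc [[2, 3, 4]]⟩],
   [⟨rel [13, 23, 34] [(24, 1), (24, 13)], 3, cyc [[3, 4]]⟩,
    ⟨rel [14, 24, 34] [(23, 0), (23, 4)], 38, cyc []⟩,
    ⟨rel [12, 23, 24] [(34, 0), (34, 2)], 38, cyc [[2, 3, 4]]⟩],
   [⟨rel [] [(14, 0), (14, 3), (23, 0), (23, 4), (34, 0), (34, 1), (34, 2)], 40, cyc []⟩,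
    ⟨rel [] [(13, 0), (13, 2), (13, 4), (14, 0), (14, 3), (23, 0), (23, 1)], 40, cyc [[1, 2, 4, 3]]⟩],
   [⟨rel [13, 14, 23, 24] [], 4, cyc []⟩,
    ⟨rel [] [(14, 0), (14, 3), (23, 0), (23, 4), (34, 0), (34, 1), (34, 2)], 40, cyc []⟩],
   [⟨rel [13, 14, 23, 24] [], 4, cyc []⟩,
    ⟨rel [12, 14, 23, 34] [], 4, cyc [[2, 3, 4]]⟩,
    ⟨rel [14, 24, 34] [(23, 0), (23, 4)], 38, cyc []⟩,
    ⟨rel [12, 13, 14] [(23, 0), (23, 1)], 38, cyc [[1, 4], [2, 3]]⟩],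
   [⟨rel [13, 14, 23, 24] [], 4, cyc []⟩,
    ⟨rel [12, 14, 23, 34] [], 4, cyc [[2, 3, 4]]⟩,
    ⟨rel [14, 24, 34] [(23, 0), (23, 4)], 38, cyc []⟩],
   [⟨rel [] [(23, 0), (23, 4), (34, 0), (34, 2)], 41, cyc []⟩,
    ⟨rel [] [(23, 0), (23, 4), (24, 0), (24, 3)], 41, cyc [[2, 4, 3]]⟩],
   [⟨rel [] [(14, 3), (14, 23), (23, 0), (23, 4), (24, 0), (24, 3), (24, 13)], 10, cyc [[1, 3, 4]]⟩,
    ⟨rel [] [(14, 0), (14, 3), (23, 0), (23, 4), (34, 0), (34, 1), (34, 2)], 40, cyc []⟩],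
   [⟨rel [12, 23, 24] [], 5, cyc [[2, 3, 4]]⟩,
    ⟨rel [] [(12, 0), (12, 3), (12, 4), (14, 0), (14, 2), (23, 0), (23, 1)], 40, cyc [[1, 3], [2, 4]]⟩,
    ⟨rel [] [(12, 4), (13, 0), (13, 2), (23, 0), (23, 1)], 42, cyc [[1, 4, 2]]⟩],
   [⟨rel [13, 23, 34] [], 5, cyc [[3, 4]]⟩,
    ⟨rel [12, 23, 24] [], 5, cyc [[2, 3, 4]]⟩,
    ⟨rel [] [(12, 0), (12, 3), (23, 0), (23, 1), (23, 4), (34, 0), (34, 2)], 40, cyc [[2, 4]]⟩,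
    ⟨rel [] [(13, 0), (13, 2), (23, 0), (23, 1), (23, 4), (24, 0), (24, 3)], 40, cyc [[2, 4, 3]]⟩]]

/-- The couples on `Fin 4` in digit notation. -/
def coupleCode : List (ℕ × ℕ) :=
  [(12, 0), (12, 3), (12, 4), (12, 34), (13, 0), (13, 2), (13, 4), (13, 24),
   (14, 0), (14, 2), (14, 3), (14, 23), (23, 0), (23, 1), (23, 4), (23, 14),
   (24, 0), (24, 1), (24, 3), (24, 13), (34, 0), (34, 1), (34, 2), (34, 12)]

/-- The digit code of the `k`-th couple. -/
def code (k : Fin 24) : ℕ × ℕ := coupleCode.getD k 0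

theorem code_valid : ∀ k : Fin 24, (digitSet (code k).1).card = 2 ∧
    Disjoint (digitSet (code k).1) (digitSet (code k).2) := by
  decide +kernel

/-- The `k`-th couple on `Fin 4`. -/
def couple (k : Fin 24) : CICouple 4 :=
  ⟨(digitSet (code k).1, digitSet (code k).2), code_valid k⟩

theorem couple_surjective : Function.Surjective couple := by
  unfold Function.Surjective
  decide +kernel

theorem couple_injective : Function.Injective couple := by
  unfold Function.Injective
  decide +kernel

/-- The relation on `Fin 4` whose couples are the nonzero binary digits of `n`. -/
def decode (n : ℕ) : CIRelation 4 :=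
  Finset.univ.filter fun q => ∃ k : Fin 24, n.testBit k = true ∧ couple k = q

/-- The bit mask of a relation on `Fin 4`. -/
def encode (L : CIRelation 4) : ℕ := Nat.ofBits fun k : Fin 24 => decide (couple k ∈ L)

theorem couple_mem_decode {n : ℕ} {k : Fin 24} :
    couple k ∈ decode n ↔ n.testBit k = true := by
  simp only [decode, Finset.mem_filter, Finset.mem_univ, true_and]
  exact ⟨fun ⟨j, hj, h⟩ => couple_injective h ▸ hj, fun h => ⟨k, h, rfl⟩⟩

theorem relation_ext {K L : CIRelation 4} (h : ∀ k, couple k ∈ K ↔ couple k ∈ L) : K = L := by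
  ext q
  obtain ⟨k, rfl⟩ := couple_surjective q
  exact h k

theorem subset_iff_couple {K L : CIRelation 4} :
    K ⊆ L ↔ ∀ k, couple k ∈ K → couple k ∈ L := by
  refine ⟨fun h k hk => h hk, fun h q hq => ?_⟩
  obtain ⟨k, rfl⟩ := couple_surjective q
  exact h k hq

theorem encode_lt (L : CIRelation 4) : encode L < 2 ^ 24 := Nat.ofBits_lt_two_pow _

theorem testBit_encode (L : CIRelation 4) (k : Fin 24) :
    (encode L).testBit k = decide (couple k ∈ L) := by
  rw [encode, Nat.testBit_ofBits_lt _ _ k.2]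

theorem decode_encode (L : CIRelation 4) : decode (encode L) = L :=
  relation_ext fun k => by rw [couple_mem_decode, testBit_encode, decide_eq_true_iff]

theorem eq_of_testBit_fin {m n : ℕ} (hm : m < 2 ^ 24) (hn : n < 2 ^ 24)
    (h : ∀ k : Fin 24, m.testBit k = n.testBit k) : m = n := by
  refine Nat.eq_of_testBit_eq fun i => ?_
  by_cases hi : i < 24
  · exact h ⟨i, hi⟩
  · rw [Nat.testBit_eq_false_of_lt (hm.trans_le (Nat.pow_le_pow_right (by norm_num) (not_lt.1 hi))),
      Nat.testBit_eq_false_of_lt (hn.trans_le (Nat.pow_le_pow_right (by norm_num) (not_lt.1 hi)))]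

theorem encode_decode {n : ℕ} (hn : n < 2 ^ 24) : encode (decode n) = n :=
  eq_of_testBit_fin (encode_lt _) hn fun k => by
    rw [testBit_encode, Bool.eq_iff_iff, decide_eq_true_iff, couple_mem_decode]

theorem decode_injective {m n : ℕ} (hm : m < 2 ^ 24) (hn : n < 2 ^ 24)
    (h : decode m = decode n) : m = n := by
  rw [← encode_decode hm, h, encode_decode hn]

theorem decode_subset_decode {m n : ℕ} (hm : m < 2 ^ 24) :
    decode m ⊆ decode n ↔ m &&& n = m := by
  simp only [subset_iff_couple, couple_mem_decode]
  constructor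
  · refine fun h => eq_of_testBit_fin (lt_of_le_of_lt Nat.and_le_left hm) hm fun k => ?_
    have := h k
    rw [Nat.testBit_and]
    cases h1 : m.testBit k <;> cases h2 : n.testBit k <;> simp_all
  · intro h k hk
    rw [← h, Nat.testBit_and, Bool.and_eq_true] at hk
    exact hk.2

/-! Relations given by digits. -/

/-- The bit mask of `digitSet n`, with bit `k` for the label `k`. -/
def digitMask (n : ℕ) : ℕ := (2 ^ (n % 10) ||| 2 ^ (n / 10)) &&& 30

theorem testBit_digitMask (n : ℕ) (k : Fin 4) :
    (digitMask n).testBit (k + 1) = decide (k ∈ digitSet n) := by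
  have h30 : (30 : ℕ).testBit (k + 1) = true := by revert k; decide
  rw [digitMask, Nat.testBit_and, Nat.testBit_or, h30, Bool.and_true, Nat.testBit_two_pow,
    Nat.testBit_two_pow, ← Bool.decide_or]
  exact decide_eq_decide.2 (by simp [digitSet, eq_comm])

theorem digitSet_eq_iff {a b : ℕ} : digitSet a = digitSet b ↔ digitMask a = digitMask b := by
  constructor
  · intro h
    refine Nat.eq_of_testBit_eq fun i => ?_
    rcases i with _ | i
    · simp [digitMask]
    · by_cases hi : i < 4
      · rw [testBit_digitMask a ⟨i, hi⟩, testBit_digitMask b ⟨i, hi⟩, h]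
      · have : (30 : ℕ).testBit (i + 1) = false :=
          Nat.testBit_eq_false_of_lt (lt_of_lt_of_le (by norm_num : 30 < 2 ^ 5)
            (Nat.pow_le_pow_right (by norm_num) (by omega)))
        rw [digitMask, digitMask, Nat.testBit_and, Nat.testBit_and, this, Bool.and_false,
          Bool.and_false]
  · intro h
    ext k
    rw [← decide_eq_decide, ← testBit_digitMask, ← testBit_digitMask, h]

/-- The bit mask of `rel stars couples`. -/
def relMask (stars : List ℕ) (couples : List (ℕ × ℕ)) : ℕ :=
  Nat.ofBits fun k : Fin 24 =>
    (stars.any fun p => Nat.beq (digitMask (code k).1) (digitMask p)) ||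
    (couples.any fun a => Nat.beq (digitMask (code k).1) (digitMask a.1) &&
      Nat.beq (digitMask (code k).2) (digitMask a.2))

theorem rel_eq_decode (stars : List ℕ) (couples : List (ℕ × ℕ)) :
    rel stars couples = decode (relMask stars couples) := by
  refine relation_ext fun k => ?_
  rw [couple_mem_decode, relMask, Nat.testBit_ofBits_lt _ _ k.2]
  simp [rel, couple, digitSet_eq_iff, Nat.beq_eq]

/-! The action of permutations on bit masks. -/

/-- The transpositions of neighbours in `Fin 4`. -/
def gen : Fin 3 → Equiv.Perm (Fin 4) := ![Equiv.swap 0 1, Equiv.swap 1 2, Equiv.swap 2 3]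

/-- The action of the transpositions of neighbours on the positions of the couples. -/
def genIndex : Fin 3 → Fin 24 → Fin 24 :=
  ![![0, 1, 2, 3, 12, 13, 14, 15, 16, 17, 18, 19, 4, 5, 6, 7, 8, 9, 10, 11, 20, 22, 21, 23],
    ![4, 5, 6, 7, 0, 1, 2, 3, 8, 10, 9, 11, 12, 13, 14, 15, 20, 21, 22, 23, 16, 17, 18, 19],
    ![0, 2, 1, 3, 8, 9, 10, 11, 4, 5, 6, 7, 16, 17, 18, 19, 12, 13, 14, 15, 20, 21, 22, 23]]

theorem permuteCouple_gen : ∀ i k, permuteCouple (gen i) (couple k) = couple (genIndex i k) := by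
  decide +kernel

/-- The binary digits of `n` that are selected by `fixed` stay, those selected by `far` change
places with those `d` places higher, and those selected by `near` with their upper neighbours. -/
def maskSwap (fixed d far near n : ℕ) : ℕ :=
  ((n &&& fixed) ||| ((n &&& far) <<< d) ||| ((n >>> d) &&& far) |||
    ((n &&& near) <<< 1) ||| ((n >>> 1) &&& near)) &&& 16777215

/-- The action of the transpositions of neighbours on bit masks. -/
def act (i : Fin 3) (n : ℕ) : ℕ :=
  match i with
  | 0 => maskSwap 0x90000F 8 0xFF0 0x200000 n
  | 1 => maskSwap 0xF900 4 0xF000F 0x200 n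
  | 2 => maskSwap 0xF00009 4 0xF0F0 0x2 n

theorem act_lt (i : Fin 3) (n : ℕ) : act i n < 2 ^ 24 := by
  fin_cases i <;> exact Nat.and_lt_two_pow _ (by norm_num)

theorem testBit_maskSwap (fixed d far near n k : ℕ) :
    (maskSwap fixed d far near n).testBit k =
      ((n.testBit k && fixed.testBit k ||
      decide (d ≤ k) && (n.testBit (k - d) && far.testBit (k - d)) ||
      n.testBit (k + d) && far.testBit k ||
      decide (1 ≤ k) && (n.testBit (k - 1) && near.testBit (k - 1)) ||
      n.testBit (k + 1) && near.testBit k) && (16777215 : ℕ).testBit k) := by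
  simp only [maskSwap, Nat.testBit_and, Nat.testBit_or, Nat.testBit_shiftLeft,
    Nat.testBit_shiftRight, add_comm k, ge_iff_le]

theorem testBit_act (i : Fin 3) (n : ℕ) (k : Fin 24) :
    (act i n).testBit (genIndex i k) = n.testBit k := by
  fin_cases i <;> simp only [act, testBit_maskSwap] <;> generalize n.testBit = f <;>
    fin_cases k <;> simp [genIndex, Nat.testBit]

theorem permute_gen (i : Fin 3) (n : ℕ) : permute (gen i) (decode n) = decode (act i n) := by
  have inv : ∀ i k, genIndex i (genIndex i k) = k := by decide +kernel
  refine relation_ext fun k => ?_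
  obtain ⟨j, rfl⟩ : ∃ j, genIndex i j = k := ⟨genIndex i k, inv i k⟩
  rw [couple_mem_decode, testBit_act, ← couple_mem_decode, ← permuteCouple_gen, permute]
  refine ⟨fun h => ?_, Finset.mem_image_of_mem _⟩
  obtain ⟨q, hq, h⟩ := Finset.mem_image.1 h
  obtain ⟨l, rfl⟩ := couple_surjective q
  rw [permuteCouple_gen, permuteCouple_gen] at h
  have := congrArg (genIndex i) (couple_injective h)
  rw [inv, inv] at this
  exact this ▸ hq

/-- The product of the transpositions in a word. -/
def permWord (w : List (Fin 3)) : Equiv.Perm (Fin 4) := (w.map gen).prod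

/-- The action of words in the transpositions on bit masks. -/
def actWord (w : List (Fin 3)) (n : ℕ) : ℕ := w.foldr act n

theorem permute_permWord (w : List (Fin 3)) (n : ℕ) :
    permute (permWord w) (decode n) = decode (actWord w n) := by
  induction w with
  | nil => exact permute_one _
  | cons i w ih =>
    rw [permWord, List.map_cons, List.prod_cons, permute_mul]
    exact (congrArg _ ih).trans (permute_gen _ _)

theorem actWord_lt (w : List (Fin 3)) {n : ℕ} (hn : n < 2 ^ 24) : actWord w n < 2 ^ 24 := by
  cases w with
  | nil => exact hn
  | cons i w => exact act_lt _ _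

/-- Words for the elements of the symmetric group. -/
def words : List (List (Fin 3)) :=
  [[], [2], [1, 2], [0, 1, 2]].flatMap fun u =>
    [[], [1], [0, 1]].flatMap fun v => [[], [0]].map fun w => u ++ (v ++ w)

theorem exists_word : ∀ σ : Equiv.Perm (Fin 4), ∃ w ∈ words, permWord w = σ := by
  decide +kernel

/-- The bit masks of the relations that are equivalent to the relation with bit mask `n`. -/
def orbit (n : ℕ) : List ℕ := words.map fun w => actWord w n

theorem ciEquivalent_decode {m : ℕ} {L : CIRelation 4} :
    CIEquivalent (decode m) L ↔ ∃ n ∈ orbit m, decode n = L := by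
  constructor
  · rintro ⟨σ, rfl⟩
    obtain ⟨w, hw, rfl⟩ := exists_word σ
    exact ⟨_, List.mem_map_of_mem hw, (permute_permWord w m).symm⟩
  · rintro ⟨n, hn, rfl⟩
    obtain ⟨w, -, rfl⟩ := List.mem_map.1 hn
    exact ⟨permWord w, permute_permWord w m⟩

theorem orbit_lt {m n : ℕ} (hm : m < 2 ^ 24) (hn : n ∈ orbit m) : n < 2 ^ 24 := by
  obtain ⟨w, -, rfl⟩ := List.mem_map.1 hn
  exact actWord_lt w hm

theorem ciEquivalent_decode_decode {m n : ℕ} (hm : m < 2 ^ 24) (hn : n < 2 ^ 24) :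
    CIEquivalent (decode m) (decode n) ↔ n ∈ orbit m := by
  rw [ciEquivalent_decode]
  exact ⟨fun ⟨l, hl, h⟩ => decode_injective (orbit_lt hm hl) hn h ▸ hl, fun h => ⟨n, h, rfl⟩⟩

/-! Determinants of couples and positive definiteness. -/

theorem ciDet_eq_det {m n : ℕ} (S : Matrix (Fin m) (Fin m) ℝ) (i j : Fin m) {C : Finset (Fin m)}
    (f : Fin n → Fin m) (hf : Function.Injective f) (hC : ∀ x, x ∈ C ↔ ∃ a, f a = x) :
    ciDet S i j C = (S.submatrix (Fin.cons i f : Fin (n + 1) → Fin m)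
      (Fin.cons j f : Fin (n + 1) → Fin m)).det := by
  let g : Fin n → C := fun a => ⟨f a, (hC _).2 ⟨a, rfl⟩⟩
  have hg : Function.Bijective g := by
    refine ⟨fun a b h => hf (congrArg Subtype.val h), fun x => ?_⟩
    obtain ⟨a, ha⟩ := (hC x).1 x.2
    exact ⟨a, Subtype.ext ha⟩
  let e : Fin (n + 1) ≃ Option C :=
    (finSuccEquiv n).trans (Equiv.optionCongr (Equiv.ofBijective g hg))
  rw [ciDet, ← Matrix.det_submatrix_equiv_self e]
  congr 1
  ext a b
  refine Fin.cases ?_ (fun a => ?_) a <;> refine Fin.cases ?_ (fun b => ?_) b <;>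
    simp [e, g]

theorem ciDet_swap {m : ℕ} {S : Matrix (Fin m) (Fin m) ℝ} (hS : S.IsSymm) (i j : Fin m)
    (C : Finset (Fin m)) : ciDet S j i C = ciDet S i j C := by
  rw [ciDet, ← Matrix.det_transpose, Matrix.transpose_submatrix, hS.eq, ciDet]

/-- The determinant with rows `i, l` and columns `j, l` for a list `l` of at most two indices. -/
def minor {m : ℕ} {R : Type*} [CommRing R] (A : Matrix (Fin m) (Fin m) R) (i j : Fin m) :
    List (Fin m) → R
  | [] => A i j
  | [k] => A i j * A k k - A i k * A k j
  | k :: l :: _ => A i j * (A k k * A l l - A k l * A l k) -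
      A i k * (A k j * A l l - A k l * A l j) + A i l * (A k j * A l k - A k k * A l j)

theorem minor_map {m : ℕ} {R R' : Type*} [CommRing R] [CommRing R'] (φ : R →+* R')
    (A : Matrix (Fin m) (Fin m) R) (i j : Fin m) (l : List (Fin m)) :
    minor (A.map φ) i j l = φ (minor A i j l) := by
  rcases l with _ | ⟨k, _ | ⟨l, t⟩⟩ <;> simp [minor]

theorem minor_scale {m : ℕ} (d : Fin m → ℝ) (A : Matrix (Fin m) (Fin m) ℝ) (i j : Fin m)
    (hd : ∀ i, d i ≠ 0) (l : List (Fin m)) :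
    minor (Matrix.of fun i j => d i * d j * A i j) i j l = 0 ↔ minor A i j l = 0 := by
  rcases l with _ | ⟨k, _ | ⟨l, t⟩⟩
  · simp [minor, hd]
  · have : minor (Matrix.of fun i j => d i * d j * A i j) i j [k] =
        (d i * d j * d k ^ 2) * minor A i j [k] := by
      simp only [minor, Matrix.of_apply]; ring
    simp [this, hd]
  · have : minor (Matrix.of fun i j => d i * d j * A i j) i j (k :: l :: t) =
        (d i * d j * d k ^ 2 * d l ^ 2) * minor A i j (k :: l :: t) := by
      simp only [minor, Matrix.of_apply]; ring
    simp [this, hd]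

theorem ciDet_eq_minor {m : ℕ} (S : Matrix (Fin m) (Fin m) ℝ) (i j : Fin m) {l : List (Fin m)}
    (hl : l.Nodup) (hlen : l.length ≤ 2) : ciDet S i j l.toFinset = minor S i j l := by
  rw [ciDet_eq_det S i j l.get (List.nodup_iff_injective_get.1 hl)
    (fun x => by rw [List.mem_toFinset, List.mem_iff_get])]
  rcases l with _ | ⟨k, _ | ⟨l, _ | t⟩⟩
  · simp [minor]
  · simp [minor, Matrix.det_fin_two]
  · rw [Matrix.det_fin_three]
    change S i j * S k k * S l l - S i j * S k l * S l k - S i k * S k j * S l l +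
      S i k * S k l * S l j + S i l * S k j * S l k - S i l * S k k * S l j = _
    simp only [minor]
    ring
  · simp at hlen

/-- The indices `i`, `j` and the conditioning set `C` of the couple at position `k`. -/
def coupleIndices (k : Fin 24) : Fin 4 × Fin 4 × List (Fin 4) :=
  [(0, 1, []), (0, 1, [2]), (0, 1, [3]), (0, 1, [2, 3]),
   (0, 2, []), (0, 2, [1]), (0, 2, [3]), (0, 2, [1, 3]),
   (0, 3, []), (0, 3, [1]), (0, 3, [2]), (0, 3, [1, 2]),
   (1, 2, []), (1, 2, [0]), (1, 2, [3]), (1, 2, [0, 3]),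
   (1, 3, []), (1, 3, [0]), (1, 3, [2]), (1, 3, [0, 2]),
   (2, 3, []), (2, 3, [0]), (2, 3, [1]), (2, 3, [0, 1])].getD k (0, 1, [])

/-- The determinant that belongs to the couple at position `k`. -/
def coupleMinor {R : Type*} [CommRing R] (A : Matrix (Fin 4) (Fin 4) R) (k : Fin 24) : R :=
  minor A (coupleIndices k).1 (coupleIndices k).2.1 (coupleIndices k).2.2

theorem coupleIndices_spec : ∀ k : Fin 24,
    digitSet (code k).1 = {(coupleIndices k).1, (coupleIndices k).2.1} ∧
    digitSet (code k).2 = (coupleIndices k).2.2.toFinset ∧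
    (coupleIndices k).2.2.Nodup ∧ (coupleIndices k).2.2.length ≤ 2 := by
  decide +kernel

theorem coupleHolds_iff {S : Matrix (Fin 4) (Fin 4) ℝ} (hS : S.IsSymm) (k : Fin 24) :
    CoupleHolds S (couple k) ↔ coupleMinor S k = 0 := by
  obtain ⟨h1, h2, h3, h4⟩ := coupleIndices_spec k
  rw [coupleMinor, ← ciDet_eq_minor S _ _ h3 h4, ← h2]
  constructor
  · exact fun h => h _ _ h1
  · intro h i j hij
    replace hij := h1.symm.trans hij
    have hij : ({(coupleIndices k).1, (coupleIndices k).2.1} : Set (Fin 4)) = {i, j} := by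
      rw [← Finset.coe_pair, ← Finset.coe_pair, hij]
    rcases Set.pair_eq_pair_iff.1 hij with ⟨rfl, rfl⟩ | ⟨rfl, rfl⟩
    · exact h
    · rw [ciDet_swap hS]; exact h

/-- One step of fraction-free Gaussian elimination in a symmetric matrix. -/
def eliminate {n : ℕ} {R : Type*} [CommRing R] (A : Matrix (Fin (n + 1)) (Fin (n + 1)) R) :
    Matrix (Fin n) (Fin n) R :=
  fun i j => A 0 0 * A i.succ j.succ - A 0 i.succ * A 0 j.succ

theorem isSymm_eliminate {n : ℕ} {R : Type*} [CommRing R]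
    {A : Matrix (Fin (n + 1)) (Fin (n + 1)) R} (hA : A.IsSymm) : (eliminate A).IsSymm := by
  ext i j
  simp only [Matrix.transpose_apply, eliminate, hA.apply j.succ i.succ]
  ring

theorem posDef_of_eliminate {n : ℕ} {A : Matrix (Fin (n + 1)) (Fin (n + 1)) ℝ} (hA : A.IsSymm)
    (h0 : 0 < A 0 0) (h : (eliminate A).PosDef) : A.PosDef := by
  refine Matrix.PosDef.of_dotProduct_mulVec_pos
    (by rwa [Matrix.IsHermitian, Matrix.conjTranspose_eq_transpose_of_trivial]) fun x hx => ?_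
  set y : Fin n → ℝ := fun i => x i.succ with hy
  set b : ℝ := ∑ j, A 0 j.succ * y j with hb
  have key : A 0 0 * (star x ⬝ᵥ A.mulVec x) =
      (A 0 0 * x 0 + b) ^ 2 + star y ⬝ᵥ (eliminate A).mulVec y := by
    have e1 : star x ⬝ᵥ A.mulVec x =
        A 0 0 * x 0 ^ 2 + 2 * x 0 * b + ∑ i, ∑ j, y i * (A i.succ j.succ * y j) := by
      simp only [dotProduct, Matrix.mulVec, Fin.sum_univ_succ, star_trivial, mul_add,
        Finset.sum_add_distrib, Finset.mul_sum, hb, hy]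
      have : ∀ i : Fin n, x i.succ * (A i.succ 0 * x 0) = x 0 * (A 0 i.succ * x i.succ) :=
        fun i => by rw [hA.apply 0 i.succ]; ring
      simp only [this, mul_assoc, ← Finset.mul_sum]
      ring
    have e2 : star y ⬝ᵥ (eliminate A).mulVec y =
        A 0 0 * (∑ i, ∑ j, y i * (A i.succ j.succ * y j)) - b ^ 2 := by
      rw [sq, hb, Finset.sum_mul_sum, Finset.mul_sum, ← Finset.sum_sub_distrib]
      simp only [dotProduct, Matrix.mulVec, star_trivial, Finset.mul_sum, eliminate]
      refine Finset.sum_congr rfl fun i _ => ?_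
      rw [← Finset.sum_sub_distrib]
      exact Finset.sum_congr rfl fun j _ => by ring
    rw [e1, e2]; ring
  refine pos_of_mul_pos_right (a := A 0 0) ?_ h0.le
  rw [key]
  by_cases h1 : y = 0
  · have hx0 : x 0 ≠ 0 := fun h2 => hx (funext fun i => by
      refine Fin.cases h2 (fun i => congrFun h1 i) i)
    have : b = 0 := by simp [hb, h1]
    rw [this, h1]
    simp only [add_zero, star_zero, zero_dotProduct]
    positivity
  · have := h.dotProduct_mulVec_pos h1
    positivity

/-- A sufficient test for positive definiteness of an integer matrix. -/
def posDefTest : (n : ℕ) → Matrix (Fin n) (Fin n) ℤ → Bool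
  | 0, _ => true
  | n + 1, A => decide (0 < A 0 0) && posDefTest n (eliminate A)

theorem posDef_of_posDefTest {n : ℕ} {A : Matrix (Fin n) (Fin n) ℤ} (hA : A.IsSymm)
    (h : posDefTest n A = true) : (A.map (Int.castRingHom ℝ)).PosDef := by
  induction n with
  | zero =>
    refine Matrix.PosDef.of_dotProduct_mulVec_pos (Subsingleton.elim _ _) fun x hx => ?_
    exact absurd (Subsingleton.elim x 0) hx
  | succ n ih =>
    rw [posDefTest, Bool.and_eq_true, decide_eq_true_iff] at h
    refine posDef_of_eliminate (hA.map _)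
      (by simpa using h.1) ?_
    convert ih (isSymm_eliminate hA) h.2
    ext i j
    simp [eliminate]

/-- The symmetric matrix whose upper triangle is listed by rows. -/
def symmMatrix (l : List ℤ) : Matrix (Fin 4) (Fin 4) ℤ := fun i j =>
  l.getD ([[0, 1, 2, 3], [1, 4, 5, 6], [2, 5, 7, 8], [3, 6, 8, 9]].getD i [] |>.getD j 0) 0

theorem isSymm_symmMatrix (l : List ℤ) : (symmMatrix l).IsSymm := by
  ext i j
  fin_cases i <;> fin_cases j <;> rfl

/-- The integer matrix with upper triangle `l` is positive definite and represents the relation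
with bit mask `n`. -/
def represents (l : List ℤ) (n : ℕ) : Bool :=
  posDefTest 4 (symmMatrix l) &&
    decide (∀ k : Fin 24, coupleMinor (symmMatrix l) k = 0 ↔ n.testBit k = true)

theorem isRepresentable_of_represents {l : List ℤ} {n : ℕ} (h : represents l n = true) :
    IsRepresentable (decode n) := by
  rw [represents, Bool.and_eq_true, decide_eq_true_iff] at h
  refine ⟨_, posDef_of_posDefTest (isSymm_symmMatrix l) h.1, fun q => ?_⟩
  obtain ⟨k, rfl⟩ := couple_surjective q
  rw [coupleHolds_iff ((isSymm_symmMatrix l).map _),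
    couple_mem_decode, ← h.2, coupleMinor, minor_map, coupleMinor]
  exact Int.cast_eq_zero

/-! Implications between couples that hold for all positive definite matrices. -/

/-- If all couples of the bit mask `c.1` hold for a positive definite matrix, then so does some
couple of the bit mask `c.2`. -/
def IsValidClause (c : ℕ × ℕ) : Prop :=
  ∀ S : Matrix (Fin 4) (Fin 4) ℝ, S.PosDef →
    (∀ k : Fin 24, c.1.testBit k = true → CoupleHolds S (couple k)) →
      ∃ k : Fin 24, c.2.testBit k = true ∧ CoupleHolds S (couple k)

/-- The symmetric matrix with unit diagonal and the given upper triangle. -/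
def corr (a b c d e f : ℝ) : Matrix (Fin 4) (Fin 4) ℝ :=
  !![1, a, b, c; a, 1, d, e; b, d, 1, f; c, e, f, 1]

theorem isSymm_of_posDef {n : ℕ} {S : Matrix (Fin n) (Fin n) ℝ} (hS : S.PosDef) : S.IsSymm := by
  have := hS.isHermitian
  rwa [Matrix.IsHermitian, Matrix.conjTranspose_eq_transpose_of_trivial] at this

theorem exists_corr {S : Matrix (Fin 4) (Fin 4) ℝ} (hS : S.PosDef) :
    ∃ a b c d e f : ℝ, (corr a b c d e f).PosDef ∧
      ∀ k, CoupleHolds S (couple k) ↔ coupleMinor (corr a b c d e f) k = 0 := by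
  have hsymm := isSymm_of_posDef hS
  set r : Fin 4 → ℝ := fun i => (√(S i i))⁻¹ with hr
  have hr0 : ∀ i, r i ≠ 0 := fun i => inv_ne_zero (Real.sqrt_ne_zero'.2 hS.diag_pos)
  have hdiag : ∀ i, r i * r i * S i i = 1 := fun i => by
    rw [hr, ← mul_inv, Real.mul_self_sqrt hS.diag_pos.le, inv_mul_cancel₀ hS.diag_pos.ne']
  have hT : (Matrix.of fun i j => r i * r j * S i j) = corr (r 0 * r 1 * S 0 1)
      (r 0 * r 2 * S 0 2) (r 0 * r 3 * S 0 3) (r 1 * r 2 * S 1 2) (r 1 * r 3 * S 1 3)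
      (r 2 * r 3 * S 2 3) := by
    ext i j
    fin_cases i <;> fin_cases j <;> simp only [corr] <;>
      first
      | exact hdiag _
      | rfl
      | (rw [Matrix.of_apply, mul_comm (r _), ← hsymm.apply]; rfl)
  suffices h : (Matrix.of fun i j => r i * r j * S i j).PosDef ∧
      ∀ k, CoupleHolds S (couple k) ↔ coupleMinor (Matrix.of fun i j => r i * r j * S i j) k = 0 by
    rw [hT] at h
    exact ⟨_, _, _, _, _, _, h⟩
  constructor
  · have hinj : Function.Injective (Matrix.diagonal r).mulVec := by
      rw [Matrix.mulVec_injective_iff_isUnit, Matrix.isUnit_iff_isUnit_det, Matrix.det_diagonal]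
      exact (Finset.prod_ne_zero_iff.2 fun i _ => hr0 i).isUnit
    convert hS.conjTranspose_mul_mul_same hinj
    ext i j
    rw [Matrix.diagonal_conjTranspose, Matrix.mul_diagonal, Matrix.diagonal_mul]
    simp only [Matrix.of_apply, Pi.star_apply, star_trivial]
    ring
  · intro k
    rw [coupleHolds_iff hsymm, coupleMinor, coupleMinor, minor_scale r S _ _ hr0]

theorem corr_pos {a b c d e f : ℝ} (h : (corr a b c d e f).PosDef) :
    (0 < 1 - a ^ 2 ∧ 0 < 1 - b ^ 2 ∧ 0 < 1 - c ^ 2 ∧ 0 < 1 - d ^ 2 ∧ 0 < 1 - e ^ 2 ∧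
      0 < 1 - f ^ 2) ∧
    0 < 1 + 2 * a * b * d - a ^ 2 - b ^ 2 - d ^ 2 ∧
    0 < 1 + 2 * a * c * e - a ^ 2 - c ^ 2 - e ^ 2 ∧
    0 < 1 + 2 * b * c * f - b ^ 2 - c ^ 2 - f ^ 2 ∧
    0 < 1 + 2 * d * e * f - d ^ 2 - e ^ 2 - f ^ 2 := by
  have two : ∀ i j : Fin 4, i ≠ j → 0 < ((corr a b c d e f).submatrix ![i, j] ![i, j]).det :=
    fun i j hij => (h.submatrix (by
      intro x y; fin_cases x <;> fin_cases y <;> simp [hij, hij.symm])).det_pos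
  have three : ∀ i j k : Fin 4, i ≠ j → i ≠ k → j ≠ k →
      0 < ((corr a b c d e f).submatrix ![i, j, k] ![i, j, k]).det :=
    fun i j k hij hik hjk => (h.submatrix (by
      intro x y; fin_cases x <;> fin_cases y <;>
        simp [hij, hij.symm, hik, hik.symm, hjk, hjk.symm])).det_pos
  have h1 := two 0 1 (by decide)
  have h2 := two 0 2 (by decide)
  have h3 := two 0 3 (by decide)
  have h4 := two 1 2 (by decide)
  have h5 := two 1 3 (by decide)
  have h6 := two 2 3 (by decide)
  have h7 := three 0 1 2 (by decide) (by decide) (by decide)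
  have h8 := three 0 1 3 (by decide) (by decide) (by decide)
  have h9 := three 0 2 3 (by decide) (by decide) (by decide)
  have h10 := three 1 2 3 (by decide) (by decide) (by decide)
  simp only [Matrix.det_fin_two, Matrix.det_fin_three, Matrix.submatrix_apply, corr,
    Matrix.of_apply, Matrix.cons_val] at h1 h2 h3 h4 h5 h6 h7 h8 h9 h10
  refine ⟨⟨?_, ?_, ?_, ?_, ?_, ?_⟩, ?_, ?_, ?_, ?_⟩ <;> linarith

/-- The bit mask of a list of positions. -/
def indexMask (l : List (Fin 24)) : ℕ := l.foldr (fun (k : Fin 24) n => 2 ^ (k : ℕ) ||| n) 0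

theorem testBit_indexMask (l : List (Fin 24)) (k : Fin 24) :
    (indexMask l).testBit k = true ↔ k ∈ l := by
  induction l with
  | nil => simp [indexMask]
  | cons j l ih =>
    rw [indexMask, List.foldr_cons, Nat.testBit_or, Bool.or_eq_true, ← indexMask, ih,
      Nat.testBit_two_pow, decide_eq_true_iff, List.mem_cons, Fin.val_inj, eq_comm]

theorem isValidClause_of_corr (p q : List (Fin 24))
    (h : ∀ a b c d e f : ℝ, (corr a b c d e f).PosDef →
      (∀ k ∈ p, coupleMinor (corr a b c d e f) k = 0) →
        ∃ k ∈ q, coupleMinor (corr a b c d e f) k = 0) :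
    IsValidClause (indexMask p, indexMask q) := by
  intro S hS hp
  obtain ⟨a, b, c, d, e, f, hpos, hk⟩ := exists_corr hS
  obtain ⟨k, hkq, h0⟩ := h a b c d e f hpos fun k hkp =>
    (hk k).1 (hp k ((testBit_indexMask p k).2 hkp))
  exact ⟨k, (testBit_indexMask q k).2 hkq, (hk k).2 h0⟩

/-- Implications between couples, as pairs of lists of positions. -/
def baseClauses : List (List (Fin 24) × List (Fin 24)) :=
  [([0, 5], [4]), ([1, 5], [0]), ([0, 4], [1]), ([0, 1], [4, 12]), ([2, 7], [6]), ([3, 7], [2]),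
   ([2, 6], [3]), ([2, 3], [6, 14]), ([1, 6, 9], [0]), ([8, 11, 13, 14], [12]),
   ([6, 11, 13, 16], [8]), ([4, 11, 15, 16], [8]), ([5, 10, 14, 17], [4])]

theorem isValidClause_baseClauses : ∀ c ∈ baseClauses,
    IsValidClause (indexMask c.1, indexMask c.2) := by
  simp only [baseClauses, List.forall_mem_cons, List.not_mem_nil, false_implies, implies_true,
    and_true]
  refine ⟨?_, ?_, ?_, ?_, ?_, ?_, ?_, ?_, ?_, ?_, ?_, ?_, ?_⟩ <;>
    refine isValidClause_of_corr _ _ fun a b c d e f hpos h => ?_ <;>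
    obtain ⟨⟨ha, hb, hc, hd, he, hf⟩, habd, hace, hbcf, hdef⟩ := corr_pos hpos <;>
    clear hpos <;>
    simp [coupleMinor, coupleIndices, minor, corr] at h ⊢
  · linear_combination h.2 + d * h.1
  · exact (mul_eq_zero.1 (show a * (1 - d ^ 2) = 0 by
      linear_combination h.1 + d * h.2)).resolve_right hd.ne'
  · linear_combination h.1 - d * h.2
  · exact mul_eq_zero.1 (show b * d = 0 by linear_combination h.1 - h.2)
  · exact (mul_eq_zero.1 (show (b - c * f) * (1 - e ^ 2) = 0 by
      linear_combination h.2 + (d - e * f) * h.1)).resolve_right he.ne'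
  · exact (mul_eq_zero.1 (show (a - c * e) * (1 + 2 * d * e * f - d ^ 2 - e ^ 2 - f ^ 2) = 0 by
      linear_combination (1 - e ^ 2) * h.1 + (d - e * f) * h.2)).resolve_right hdef.ne'
  · linear_combination (1 - f ^ 2) * h.1 - (d - e * f) * h.2
  · exact mul_eq_zero.1 (show (b - c * f) * (d - e * f) = 0 by
      linear_combination (1 - f ^ 2) * h.1 - h.2)
  · obtain ⟨h1, h2, h3⟩ := h
    refine (mul_eq_zero.1 (show a * (1 - d * e * f) = 0 by
      linear_combination h1 + d * h2 + d * f * h3)).resolve_right fun h0 => ?_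
    have h4 : d ^ 2 * e ^ 2 < 1 :=
      mul_lt_one_of_nonneg_of_lt_one_left (sq_nonneg d) (by linarith) (by linarith)
    have h5 : d ^ 2 * e ^ 2 * f ^ 2 < 1 :=
      mul_lt_one_of_nonneg_of_lt_one_left (by positivity) h4 (by linarith)
    have h6 : d ^ 2 * e ^ 2 * f ^ 2 = 1 := by linear_combination (-1 - d * e * f) * h0
    exact h5.ne h6
  · obtain ⟨rfl, h2, h3, h4⟩ := h
    have h5 : a * e * (1 - b ^ 2 - f ^ 2) = -(b * f) := by
      linear_combination -h2 + a * f * h4 + b * e * h3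
    have h6 : b * f * (1 - a ^ 2 - e ^ 2) = -(a * e) := by
      linear_combination -h2 + a * f * h3 + b * e * h4
    have h7 : d ^ 2 = (a * e) * (b * f) := by linear_combination d * h3 + a * b * h4
    by_cases h8 : a * e = 0
    · rw [h8, zero_mul] at h7
      exact pow_eq_zero_iff two_ne_zero |>.1 h7
    · have h9 : (1 - b ^ 2 - f ^ 2) * (1 - a ^ 2 - e ^ 2) = 1 :=
        mul_left_cancel₀ h8 (by linear_combination (1 - a ^ 2 - e ^ 2) * h5 - h6)
      have h10 : b ^ 2 = 0 := by
        nlinarith [sq_nonneg a, sq_nonneg e, sq_nonneg b, sq_nonneg f]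
      have h11 : b = 0 := pow_eq_zero_iff two_ne_zero |>.1 h10
      rw [h11] at h3
      linear_combination h3
  · obtain ⟨h1, h2, h3, rfl⟩ := h
    have h4 : 0 ≤ a ^ 2 * f ^ 2 * (1 - c ^ 2) := mul_nonneg (by positivity) hc.le
    refine (mul_eq_zero.1 (show c * (1 - f ^ 2 + a ^ 2 * f ^ 2 * (1 - c ^ 2)) = 0 by
      obtain rfl : b = c * f := by linear_combination h1
      obtain rfl : d = a * (c * f) := by linear_combination h3
      linear_combination h2)).resolve_right (by positivity)
  · obtain ⟨rfl, h2, h3, rfl⟩ := h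
    by_contra hc0
    have h4 : d ^ 2 = c ^ 2 := by linear_combination d * h3 - c * h2
    have h5 : (a ^ 2 * f ^ 2 - (1 - d ^ 2) ^ 2) * c ^ 2 = 0 := by
      linear_combination (a * d * f - c * (1 - d * d)) * h2 - a ^ 2 * f ^ 2 * h4
    have h6 := (mul_eq_zero.1 h5).resolve_right (pow_ne_zero 2 hc0)
    have h7 : a ^ 2 * f ^ 2 < (1 - d ^ 2) * (1 - d ^ 2) :=
      mul_lt_mul'' (by linarith) (by linarith) (sq_nonneg a) (sq_nonneg f)
    linarith
  · obtain ⟨h1, h2, h3, h4⟩ := h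
    have h5 : a ^ 2 * f ^ 2 < 1 :=
      mul_lt_one_of_nonneg_of_lt_one_left (sq_nonneg a) (by linarith) (by linarith)
    exact (mul_eq_zero.1 (show b * (1 - a ^ 2 * f ^ 2) = 0 by
      linear_combination h1 + a * h3 + a * f * h4 + a ^ 2 * f * h2)).resolve_right (by linarith)

theorem coupleHolds_submatrix {m : ℕ} (S : Matrix (Fin m) (Fin m) ℝ) (σ : Equiv.Perm (Fin m))
    (q : CICouple m) : CoupleHolds (S.submatrix σ σ) q ↔ CoupleHolds S (permuteCouple σ q) := by
  have hdet : ∀ i j, ciDet (S.submatrix σ σ) i j q.1.2 =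
      ciDet S (σ i) (σ j) (q.1.2.map σ.toEmbedding) := fun i j => by
    let e : (q.1.2 : Finset (Fin m)) ≃ (q.1.2.map σ.toEmbedding : Finset (Fin m)) :=
      σ.subtypeEquiv fun x => by simp
    rw [ciDet, ciDet, ← Matrix.det_submatrix_equiv_self (Equiv.optionCongr e)]
    congr 1
    ext (_ | x) (_ | y) <;> rfl
  constructor
  · intro h i j hij
    have := h (σ.symm i) (σ.symm j) (by
      have h1 : q.1.1 = (permuteCouple σ q).1.1.map σ.symm.toEmbedding := by
        ext x; simp [permuteCouple]
      rw [h1, hij]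
      simp [Finset.map_insert])
    rw [hdet, σ.apply_symm_apply, σ.apply_symm_apply] at this
    exact this
  · intro h i j hij
    rw [hdet]
    exact h _ _ (by simp [permuteCouple, hij, Finset.map_insert])

theorem isValidClause_act (i : Fin 3) {c : ℕ × ℕ} (h : IsValidClause c) :
    IsValidClause (act i c.1, act i c.2) := by
  intro S hS hp
  obtain ⟨k, hk, hk'⟩ := h (S.submatrix (gen i) (gen i)) (hS.submatrix (gen i).injective)
    fun k hk => by
      rw [coupleHolds_submatrix, permuteCouple_gen]
      exact hp _ (by rw [testBit_act, hk])
  refine ⟨genIndex i k, by rw [testBit_act, hk], ?_⟩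
  rwa [coupleHolds_submatrix, permuteCouple_gen] at hk'

theorem isValidClause_actWord (w : List (Fin 3)) {c : ℕ × ℕ} (h : IsValidClause c) :
    IsValidClause (actWord w c.1, actWord w c.2) := by
  induction w with
  | nil => exact h
  | cons i w ih =>
    rw [actWord, actWord, List.foldr_cons, List.foldr_cons]
    exact isValidClause_act i (c := (actWord w c.1, actWord w c.2)) ih

/-! Exhaustive searches over bit masks. -/

/-- A search that fixes the binary digits of a number one by one, starting from position `k`.
The state is updated by `next` with each digit; `none` closes a branch. -/
def search {σ : Type} (next : ℕ → Bool → σ → Option σ) (leaf : σ → Bool) : ℕ → ℕ → σ → Bool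
  | 0, _, s => leaf s
  | f + 1, k, s =>
    (match next k false s with
      | none => true
      | some t => search next leaf f (k + 1) t) &&
    (match next k true s with
      | none => true
      | some t => search next leaf f (k + 1) t)

theorem search_sound {σ : Type} {next : ℕ → Bool → σ → Option σ} {leaf : σ → Bool} {n : ℕ}
    (Inv : ℕ → σ → Prop)
    {f k : ℕ} (hnext : ∀ i s, i < k + f → Inv i s →
      ∃ t, next i (n.testBit i) s = some t ∧ Inv (i + 1) t) {s : σ} (hs : Inv k s)
    (h : search next leaf f k s = true) :
    ∃ t, Inv (k + f) t ∧ leaf t = true := by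
  induction f generalizing k s with
  | zero => exact ⟨s, hs, h⟩
  | succ f ih =>
    obtain ⟨t, ht, hI⟩ := hnext k s (by omega) hs
    rw [search, Bool.and_eq_true] at h
    rw [← add_assoc, add_right_comm] at hnext ⊢
    cases hb : n.testBit k with
    | false => rw [hb] at ht; rw [ht] at h; exact ih hnext hI h.1
    | true => rw [hb] at ht; rw [ht] at h; exact ih hnext hI h.2

/-- Put the digit `b` at position `k`. -/
def setDigit (k : ℕ) (b : Bool) (n : ℕ) : ℕ := if b then Nat.add n (Nat.pow 2 k) else n

theorem setDigit_mod (n k : ℕ) : setDigit k (n.testBit k) (n % 2 ^ k) = n % 2 ^ (k + 1) := by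
  rw [Nat.mod_pow_succ, ← Nat.toNat_testBit]
  cases n.testBit k <;> simp [setDigit]

/-- The clause `c` holds for the bit mask `n`. -/
def clauseTest (c : ℕ × ℕ) (n : ℕ) : Bool :=
  !(Nat.beq (Nat.land n c.1) c.1) || !(Nat.beq (Nat.land n c.2) 0)

theorem clauseTest_mod {c : ℕ × ℕ} {k : ℕ} (h1 : c.1 < 2 ^ k) (h2 : c.2 < 2 ^ k) (n : ℕ) :
    clauseTest c (n % 2 ^ k) = clauseTest c n := by
  have key : ∀ a < 2 ^ k, Nat.land (n % 2 ^ k) a = Nat.land n a := fun a ha => by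
    change n % 2 ^ k &&& a = n &&& a
    conv_rhs => rw [← Nat.mod_eq_of_lt (lt_of_le_of_lt Nat.and_le_right ha : n &&& a < 2 ^ k),
      Nat.and_mod_two_pow, Nat.mod_eq_of_lt ha]
  rw [clauseTest, key _ h1, key _ h2, clauseTest]

/-- All images of the implications in `baseClauses`, as pairs of bit masks. -/
def allClauses : List (ℕ × ℕ) :=
  baseClauses.flatMap fun c => words.map fun w =>
    (actWord w (indexMask c.1), actWord w (indexMask c.2))

theorem isValidClause_allClauses : ∀ c ∈ allClauses, IsValidClause c := by
  intro c hc
  obtain ⟨b, hb, hc⟩ := List.mem_flatMap.1 hc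
  obtain ⟨w, -, rfl⟩ := List.mem_map.1 hc
  exact isValidClause_actWord w (isValidClause_baseClauses b hb)

/-- The clauses in `allClauses` whose greatest position is `k`. -/
def levelClauses (k : ℕ) : List (ℕ × ℕ) :=
  allClauses.filter fun c => Nat.beq (Nat.log2 (Nat.lor c.1 c.2)) k

/-- The step of the search for bit masks that satisfy all clauses; the second component of the
state lists the members of a given list with the same lower digits. -/
def nextClosed (k : ℕ) (b : Bool) (s : ℕ × List ℕ) : Option (ℕ × List ℕ) :=
  if (levelClauses k).all fun c => clauseTest c (setDigit k b s.1) then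
    some (setDigit k b s.1, s.2.filter fun m => m.testBit k == b)
  else none

theorem mem_of_search_nextClosed {T : List ℕ} {n : ℕ} (hn : n < 2 ^ 24)
    (hc : ∀ c ∈ allClauses, clauseTest c n = true)
    (h : search nextClosed (fun s => s.2.any (Nat.beq s.1)) 24 0 (0, T) = true) : n ∈ T := by
  obtain ⟨t, ⟨h1, h2⟩, h3⟩ := search_sound (n := n)
    (fun k s => s.1 = n % 2 ^ k ∧ s.2 ⊆ T) (fun k s _ hs => by
      refine ⟨(n % 2 ^ (k + 1), s.2.filter fun m => m.testBit k == n.testBit k), ?_, rfl,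
        fun m hm => hs.2 (List.mem_of_mem_filter hm)⟩
      rw [nextClosed, hs.1, setDigit_mod, if_pos]
      refine List.all_eq_true.2 fun c hck => ?_
      obtain ⟨hca, hk⟩ := List.mem_filter.1 hck
      have hk : Nat.log2 (c.1 ||| c.2) = k := Nat.eq_of_beq_eq_true hk
      have hlt : c.1 ||| c.2 < 2 ^ (k + 1) := hk ▸ Nat.lt_log2_self
      rw [clauseTest_mod (lt_of_le_of_lt Nat.left_le_or hlt)
        (lt_of_le_of_lt Nat.right_le_or hlt), hc c hca]) ⟨by rw [pow_zero, Nat.mod_one],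
        List.Subset.refl _⟩ h
  obtain ⟨m, hm, hm'⟩ := List.any_eq_true.1 h3
  rw [Nat.eq_of_beq_eq_true hm', zero_add, Nat.mod_eq_of_lt hn] at h1
  exact h2 (h1 ▸ hm)

/-- The step of the search for the intersections of bit masks in a given list. The second component
of the state lists the masks that contain the digits found so far, the third one the candidates. -/
def nextIntersection (k : ℕ) (b : Bool) (s : ℕ × List ℕ × List ℕ) : Option (ℕ × List ℕ × List ℕ) :=
  match b with
  | false =>
    if s.2.1.any fun m => !m.testBit k then
      some (s.1, s.2.1, s.2.2.filter fun m => !m.testBit k)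
    else none
  | true =>
    let n := setDigit k true s.1
    let R := s.2.1.filter fun m => m.testBit k
    let m := R.foldl Nat.land (Nat.sub (Nat.pow 2 k) 1)
    if Nat.beq (Nat.land m n) m then some (n, R, s.2.2.filter fun m => m.testBit k) else none

theorem testBit_foldl_land (R : List ℕ) (m j : ℕ) :
    (R.foldl Nat.land m).testBit j = true ↔ m.testBit j = true ∧ ∀ r ∈ R, r.testBit j = true := by
  induction R generalizing m with
  | nil => simp
  | cons r R ih =>
    rw [List.foldl_cons, ih, List.forall_mem_cons, ← and_assoc]
    change (m &&& r).testBit j = true ∧ _ ↔ _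
    rw [Nat.testBit_and, Bool.and_eq_true]

theorem land_eq_left_iff {n r : ℕ} :
    n &&& r = n ↔ ∀ i, n.testBit i = true → r.testBit i = true := by
  constructor
  · intro h i hi
    rw [← h, Nat.testBit_and, Bool.and_eq_true] at hi
    exact hi.2
  · refine fun h => Nat.eq_of_testBit_eq fun i => ?_
    have := h i
    rw [Nat.testBit_and]
    cases h1 : n.testBit i <;> simp_all

theorem mem_of_search_nextIntersection {R T : List ℕ} {n : ℕ} (hn : n < 2 ^ 24)
    (hc : ∀ j < 24, (∀ r ∈ R, n &&& r = n → r.testBit j = true) → n.testBit j = true)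
    (h : search nextIntersection (fun s => s.2.2.any (Nat.beq s.1)) 24 0 (0, R, T) = true) :
    n ∈ T := by
  obtain ⟨t, ⟨h1, -, h2⟩, h3⟩ := search_sound (n := n)
    (fun k s => s.1 = n % 2 ^ k ∧ (∀ r ∈ R, n &&& r = n → r ∈ s.2.1) ∧ s.2.2 ⊆ T)
    (fun k s hk hs => by
      obtain ⟨hs1, hs2, hs3⟩ := hs
      have hmod := setDigit_mod n k
      rw [← hs1] at hmod
      cases hb : n.testBit k with
      | false =>
        rw [hb] at hmod
        refine ⟨(s.1, s.2.1, s.2.2.filter fun m => !m.testBit k), ?_, hmod, hs2,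
          fun m hm => hs3 (List.mem_of_mem_filter hm)⟩
        rw [nextIntersection, if_pos]
        by_contra hall
        rw [List.any_eq_true] at hall
        push Not at hall
        rw [hc k (by omega) fun r hr hnr => by simpa using hall r (hs2 r hr hnr)] at hb
        exact Bool.noConfusion hb
      | true =>
        rw [hb] at hmod
        refine ⟨(setDigit k true s.1, s.2.1.filter fun m => m.testBit k,
          s.2.2.filter fun m => m.testBit k), ?_, hmod, fun r hr hnr =>
          List.mem_filter.2 ⟨hs2 r hr hnr, land_eq_left_iff.1 hnr k hb⟩,
          fun m hm => hs3 (List.mem_of_mem_filter hm)⟩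
        rw [nextIntersection]
        refine if_pos ?_
        rw [Nat.beq_eq]
        refine land_eq_left_iff.2 fun j hj => ?_
        obtain ⟨hj1, hj2⟩ := (testBit_foldl_land _ _ _).1 hj
        have hjk : j < k := by
          change (2 ^ k - 1).testBit j = true at hj1
          rwa [Nat.testBit_two_pow_sub_one, decide_eq_true_iff] at hj1
        rw [hmod, Nat.testBit_mod_two_pow, Bool.and_eq_true, decide_eq_true_iff]
        exact ⟨by omega, hc j (by omega) fun r hr hnr => hj2 r
          (List.mem_filter.2 ⟨hs2 r hr hnr, land_eq_left_iff.1 hnr k hb⟩)⟩)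
    ⟨by rw [pow_zero, Nat.mod_one], fun r hr _ => hr, List.Subset.refl _⟩ h
  obtain ⟨m, hm, hm'⟩ := List.any_eq_true.1 h3
  rw [Nat.eq_of_beq_eq_true hm', zero_add, Nat.mod_eq_of_lt hn] at h1
  exact h2 (h1 ▸ hm)

/-- The bit masks of the relations in `representableTable`. -/
def repMasks : List ℕ :=
  [16777215, 16777200, 16756480, 1048560, 16715520, 11182080, 14723584, 10526720, 10788864,
   10530819, 10592256, 34816, 34817, 35072, 39168, 32768, 32770, 33280, 33282, 34304, 294944,
   32769, 33793, 294913, 4227073, 33024, 33026, 295200, 36864, 37376, 2, 6, 66, 16898, 2097154,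
   2097158, 6291462, 16736000, 5591040, 7361792, 5263360, 5394432, 5787648, 4352, 4360, 6400,
   4096, 4100, 5120, 5124, 5632, 135232, 0]

/-- The bit masks of the intersections of the entries of `completeTable`. -/
def intMasks : List ℕ :=
  [16776960, 11202560, 11530240, 16773120, 15772160, 15773440, 15793920, 10543104, 10530816,
   10547200, 10547203, 10854400, 10874880, 15790080, 35328, 43520, 36608, 44800, 65280, 40960,
   41472, 49154, 57344, 32771, 49153, 49155, 33536, 41216, 41728, 45056, 61440, 61952, 5632000,
   6287360, 15750400, 15752960, 5271552, 5296128, 5304320, 5918720, 5376, 21760, 7936, 24320,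
   20480, 21504, 12292, 28672]

/-- Remove repetitions. -/
def removeRepetitions : List ℕ → List ℕ
  | [] => []
  | n :: l => if l.any (Nat.beq n) then removeRepetitions l else n :: removeRepetitions l

/-- All images of the masks in a list under permutations. -/
def orbits (l : List ℕ) : List ℕ := l.flatMap fun n => removeRepetitions (orbit n)

theorem search_closed :
    search nextClosed (fun s => s.2.any (Nat.beq s.1)) 24 0 (0, orbits repMasks) = true := by
  decide +kernel

theorem search_intersection :
    search nextIntersection (fun s => s.2.2.any (Nat.beq s.1)) 24 0
      (0, orbits repMasks, orbits (repMasks ++ intMasks)) = true := by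
  decide +kernel

/-! Tables of bit masks. -/

/-- The components of the entries of `completeTable`, each given by its bit mask, the number of an
equivalent relation in `representableTable` and the cycles of a permutation. -/
def componentData : List (List (ℕ × ℕ × List (List ℕ))) :=
  [[(16777200, 2, []), (16776975, 2, [[2, 3, 4]])], [(16445680, 3, [[3, 4]]), (11530255, 3, [[2,
   3, 4]])], [(16777200, 2, []), (11530255, 3, [[2, 3, 4]])], [(16777200, 2, []), (16776975, 2,
   [[2, 3, 4]]), (16773375, 2, [[2, 4]])], [(16756480, 3, []), (15792880, 3, [[1, 2, 4, 3]]),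
   (15793935, 4, [[2, 3, 4]])], [(16756480, 3, []), (15793935, 4, [[2, 3, 4]])], [(16777200, 2,
   []), (15793935, 4, [[2, 3, 4]])], [(15790320, 5, [[3, 4]]), (10543116, 7, [[2, 4]])],
   [(15790320, 5, [[3, 4]]), (10530819, 10, [])], [(11530255, 3, [[2, 3, 4]]), (15793935, 4, [[2,
   3, 4]]), (15790320, 5, [[3, 4]])], [(11530255, 3, [[2, 3, 4]]), (15793935, 4, [[2, 3, 4]]),
   (15790323, 38, [[1, 4, 3]])], [(16756480, 3, []), (11530255, 3, [[2, 3, 4]]), (16118000, 38,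
   [[3, 4]])], [(11530255, 3, [[2, 3, 4]]), (16118000, 38, [[3, 4]])], [(15793935, 4, [[2, 3,
   4]]), (15790320, 5, [[3, 4]])], [(14723584, 7, []), (51936, 7, [[1, 2, 4, 3]])], [(1048560, 4,
   []), (14723584, 7, [])], [(16756480, 3, []), (53247, 3, [[1, 4], [2, 3]]), (1048560, 4, []),
   (15793935, 4, [[2, 3, 4]])], [(16756480, 3, []), (1048560, 4, []), (15793935, 4, [[2, 3, 4]])],
   [(1048560, 4, []), (15793935, 4, [[2, 3, 4]])], [(10526720, 8, []), (696320, 8, [[2, 4, 3]])],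
   [(14723584, 7, []), (762624, 10, [[2, 4, 3]])], [(1044495, 5, [[2, 3, 4]]), (52238, 7, [[1, 3],
   [2, 4]]), (49346, 9, [[1, 4, 2]])], [(15790320, 5, [[3, 4]]), (1044495, 5, [[2, 3, 4]]),
   (10543116, 7, [[2, 4]]), (712896, 7, [[2, 4, 3]])], [(1044495, 5, [[2, 3, 4]]), (10530819, 10,
   []), (32819, 43, [[1, 4, 2, 3]])], [(1044495, 5, [[2, 3, 4]]), (49933, 10, [[1, 4, 3, 2]]),
   (49345, 11, [[1, 4, 2]])], [(53247, 3, [[1, 4], [2, 3]]), (15793935, 4, [[2, 3, 4]]), (1044495,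
   5, [[2, 3, 4]]), (15790323, 38, [[1, 4, 3]])], [(762624, 10, [[2, 4, 3]]), (49933, 10, [[1, 4,
   3, 2]])], [(11576576, 10, [[2, 4]]), (762624, 10, [[2, 4, 3]])], [(15793935, 4, [[2, 3, 4]]),
   (762624, 10, [[2, 4, 3]])], [(15790320, 5, [[3, 4]]), (1044495, 5, [[2, 3, 4]]), (10530819, 10,
   []), (700464, 10, [[2, 3]])], [(1048560, 4, []), (15793935, 4, [[2, 3, 4]]), (15790320, 5, [[3,
   4]]), (1044495, 5, [[2, 3, 4]])], [(15792880, 3, [[1, 2, 4, 3]]), (1048560, 4, []), (15793935,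
   4, [[2, 3, 4]]), (1045263, 38, [[1, 3], [2, 4]])], [(16118000, 38, [[3, 4]]), (6287375, 38,
   [[2, 3, 4]])], [(16777200, 2, []), (6287375, 38, [[2, 3, 4]])], [(15793935, 4, [[2, 3, 4]]),
   (16736000, 38, []), (15791600, 38, [[1, 2, 4, 3]])], [(15793935, 4, [[2, 3, 4]]), (16736000,
   38, [])], [(15790320, 5, [[3, 4]]), (5271555, 40, [[2, 4]])], [(15790320, 5, [[3, 4]]),
   (5296140, 10, [[1, 4], [2, 3]])], [(15793935, 4, [[2, 3, 4]]), (15790320, 5, [[3, 4]]),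
   (6287375, 38, [[2, 3, 4]])], [(16445680, 3, [[3, 4]]), (16736000, 38, []), (6287375, 38, [[2,
   3, 4]])], [(7361792, 40, []), (13680, 40, [[1, 2, 4, 3]])], [(1048560, 4, []), (7361792, 40,
   [])], [(1048560, 4, []), (15793935, 4, [[2, 3, 4]]), (16736000, 38, []), (16383, 38, [[1, 4],
   [2, 3]])], [(1048560, 4, []), (15793935, 4, [[2, 3, 4]]), (16736000, 38, [])], [(5263360, 41,
   []), (348160, 41, [[2, 4, 3]])], [(875520, 10, [[1, 3, 4]]), (7361792, 40, [])], [(1044495, 5,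
   [[2, 3, 4]]), (13063, 40, [[1, 3], [2, 4]]), (12340, 42, [[1, 4, 2]])], [(15790320, 5, [[3,
   4]]), (1044495, 5, [[2, 3, 4]]), (5271555, 40, [[2, 4]]), (356400, 40, [[2, 4, 3]])]]

/-- Products of cycles as words in the transpositions of neighbours. -/
def cycleWords : List (List (List ℕ) × List (Fin 3)) :=
  [([], []), ([[2, 3, 4]], [1, 2]), ([[3, 4]], [2]), ([[2, 4]], [1, 2, 1]), ([[1, 2, 4, 3]], [2,
   0, 1]), ([[1, 4, 3]], [2, 0, 1, 0]), ([[1, 4], [2, 3]], [0, 1, 2, 0, 1, 0]), ([[2, 4, 3]], [2,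
   1]), ([[1, 3], [2, 4]], [1, 2, 0, 1]), ([[1, 4, 2]], [1, 2, 1, 0]), ([[1, 4, 2, 3]], [1, 2, 0,
   1, 0]), ([[1, 4, 3, 2]], [2, 1, 0]), ([[2, 3]], [1]), ([[1, 3, 4]], [0, 1, 2, 0])]

/-- Upper triangles of integer matrices that represent the relations in `representableTable`. -/
def witnesses : List (List ℤ) :=
  [[2, 0, 0, 0, 2, 0, 0, 2, 0, 2], [2, 1, 0, 0, 2, 0, 0, 2, 0, 2], [4, 2, -2, 0, 4, -1, 0, 4, 0,
   4], [2, 1, 0, 0, 2, 0, 0, 2, -1, 2], [2, 1, -1, 0, 2, -1, 0, 2, 0, 2], [4, 2, -2, -2, 4, -1,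
   -1, 4, 1, 4], [6, 4, -3, -2, 6, -2, -3, 6, 1, 6], [4, 2, -2, -2, 4, -1, -3, 4, 1, 4], [20, -8,
   15, 8, 4, -6, -3, 12, 6, 4], [4, 0, -2, -2, 4, 0, -3, 4, 1, 4], [4, 2, -2, -2, 4, -1, 0, 4, 1,
   4], [4, 1, -3, -2, 4, -2, -3, 4, 3, 4], [3, 0, -2, -1, 3, -1, -2, 3, 2, 3], [3, 1, -1, 0, 3, 1,
   -2, 3, -2, 3], [2, 1, -1, 0, 2, 0, -1, 2, -1, 2], [3, 1, -2, -2, 3, -1, 1, 3, 1, 3], [4, 1, -2,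
   -1, 4, -2, 2, 4, -2, 4], [4, 2, -3, -1, 4, -2, -2, 4, 2, 4], [36, -9, 27, -6, 30, -16, 20, 48,
   -23, 38], [8, -6, 6, -4, 9, -6, 6, 9, -6, 8], [44, -18, 3, 16, 36, -6, 3, 36, -18, 44], [3, 0,
   -1, -2, 3, -2, 2, 3, -1, 3], [6, 0, 6, 6, 7, 6, 8, 18, 18, 22], [36, 0, 8, 27, 36, 12, 9, 36,
   27, 36], [4, 0, -1, -3, 4, -2, 2, 4, -1, 4], [2, 1, -1, 0, 2, -1, -1, 2, 1, 2], [4, 1, -2, 0,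
   4, -2, -3, 4, 2, 4], [25, 15, 3, 0, 25, 5, 4, 25, 20, 25], [3, 1, -2, -2, 3, 0, 1, 3, 2, 3],
   [4, 2, -2, -1, 4, 0, -2, 4, -2, 4], [4, 1, -2, -3, 4, -2, -3, 4, 2, 4], [4, 1, -2, -2, 4, -2,
   -2, 4, 2, 4], [6, 1, -2, -4, 6, -3, -5, 6, 3, 6], [16, 2, 8, 1, 16, 4, 8, 16, 8, 16], [4, 1,
   -2, -2, 4, -2, -3, 4, 1, 4], [12, 3, 6, 4, 12, 6, 9, 12, 2, 12], [4, 1, -2, -2, 4, -2, -2, 4,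
   1, 4], [2, 1, -1, 0, 2, 0, 0, 2, 0, 2], [2, 1, -1, -1, 2, 0, 0, 2, 0, 2], [2, 1, -1, 0, 2, 0,
   -1, 2, 0, 2], [2, 1, -1, -1, 2, 0, -1, 2, 0, 2], [4, 2, -3, -2, 4, 0, -1, 4, 0, 4], [4, 1, -2,
   -3, 4, 0, -1, 4, 0, 4], [3, 1, -2, 0, 3, 0, -1, 3, -1, 3], [4, 1, -3, 0, 4, 0, -2, 4, -2, 4],
   [3, 1, -1, 0, 3, 0, -2, 3, -2, 3], [3, 1, -2, -2, 3, 0, -1, 3, 1, 3], [4, 1, -3, -2, 4, 0, -2,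
   4, 1, 4], [4, 1, -2, -1, 4, 0, -3, 4, 2, 4], [6, 1, -4, -2, 6, 0, -3, 6, 3, 6], [4, 2, -2, -1,
   4, 0, -2, 4, 2, 4], [4, 2, -1, -2, 4, 0, -1, 4, 2, 4], [2, 1, -1, -1, 2, -1, -1, 2, 1, 2]]

theorem cyc_eq_permWord : ∀ e ∈ cycleWords, cyc e.1 = permWord e.2 := by
  decide +kernel

theorem represents_witnesses :
    ∀ i : Fin 53, represents (witnesses.getD i []) (repMasks.getD i 0) = true := by
  decide +kernel

theorem representableTable_eq : representableTable = repMasks.map decode := by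
  simp only [representableTable, rel_eq_decode, ← List.map_cons,
    ← List.map_nil (f := decode)]
  exact congrArg (List.map decode) (by decide +kernel)

/-- The component with the given bit mask, label and cycles. -/
def toComponent (d : ℕ × ℕ × List (List ℕ)) : Component := ⟨decode d.1, d.2.1, cyc d.2.2⟩

theorem component_eq (stars : List ℕ) (couples : List (ℕ × ℕ)) (l : ℕ) (cs : List (List ℕ)) :
    (⟨rel stars couples, l, cyc cs⟩ : Component) = toComponent (relMask stars couples, l, cs) := by
  rw [rel_eq_decode, toComponent]

theorem completeTable_eq : completeTable = componentData.map (List.map toComponent) := by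
  simp only [completeTable, component_eq, ← List.map_cons, ← List.map_nil (f := toComponent)]
  simp only [← List.map_cons, ← List.map_nil (f := List.map toComponent)]
  exact congrArg (List.map (List.map toComponent)) (by decide +kernel)

/-- The bit mask of the intersection of components. -/
def intersectionMask (t : List (ℕ × ℕ × List (List ℕ))) : ℕ :=
  (t.map Prod.fst).foldl Nat.land 16777215

theorem intMasks_eq : intMasks = componentData.map intersectionMask := by
  decide +kernel

theorem masks_lt : ∀ n ∈ repMasks ++ intMasks, n < 2 ^ 24 := by
  decide +kernel

theorem componentData_lt : ∀ t ∈ componentData, ∀ d ∈ t, d.1 < 2 ^ 24 := by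
  decide +kernel

theorem pairwise_orbit :
    (repMasks ++ intMasks).Pairwise fun m n => ((orbit m).any (Nat.beq n)) = false := by
  decide +kernel

theorem componentData_perm : ∀ t ∈ componentData, ∀ d ∈ t, d.2.1 - 1 < 53 ∧
    ∃ e ∈ cycleWords, e.1 = d.2.2 ∧ actWord e.2 (repMasks.getD (d.2.1 - 1) 0) = d.1 := by
  decide +kernel

theorem componentData_cover : ∀ t ∈ componentData, ((orbits repMasks).all fun m =>
    !(Nat.beq (Nat.land (intersectionMask t) m) (intersectionMask t)) ||
      t.any fun d => Nat.beq (Nat.land d.1 m) d.1) = true := by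
  decide +kernel

theorem componentData_pairwise : ∀ t ∈ componentData, t.Pairwise fun d e =>
    d.1 &&& e.1 ≠ d.1 ∧ e.1 &&& d.1 ≠ e.1 := by
  decide +kernel

/-! Representable and complete relations. -/

theorem permuteCouple_inv_apply {m : ℕ} (σ : Equiv.Perm (Fin m)) (q : CICouple m) :
    permuteCouple σ (permuteCouple σ⁻¹ q) = q := by
  apply Subtype.ext
  apply Prod.ext <;> ext x <;> simp only [permuteCouple, Finset.mem_map_equiv] <;>
    exact iff_of_eq (congrArg (· ∈ _) (σ.apply_symm_apply x))

theorem mem_permute {m : ℕ} {σ : Equiv.Perm (Fin m)} {L : CIRelation m} {q : CICouple m} :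
    q ∈ permute σ L ↔ permuteCouple σ⁻¹ q ∈ L := by
  constructor
  · intro h
    obtain ⟨p, hp, rfl⟩ := Finset.mem_image.1 h
    have := permuteCouple_inv_apply σ⁻¹ p
    rw [inv_inv] at this
    rwa [this]
  · intro h
    exact Finset.mem_image.2 ⟨_, h, permuteCouple_inv_apply σ q⟩

theorem mem_relationOf {m : ℕ} {W : Set (Matrix (Fin m) (Fin m) ℝ)} {q : CICouple m} :
    q ∈ relationOf W ↔ ∀ S ∈ W, CoupleHolds S q := by
  simp [relationOf]

theorem isRepresentable_relationOf {m : ℕ} {S : Matrix (Fin m) (Fin m) ℝ} (hS : S.PosDef) :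
    IsRepresentable (relationOf {S}) :=
  ⟨S, hS, fun q => by simp [mem_relationOf]⟩

theorem IsRepresentable.permute {m : ℕ} {L : CIRelation m} (h : IsRepresentable L)
    (σ : Equiv.Perm (Fin m)) : IsRepresentable (permute σ L) := by
  obtain ⟨S, hS, hL⟩ := h
  exact ⟨S.submatrix (σ⁻¹ : Equiv.Perm _) (σ⁻¹ : Equiv.Perm _),
    hS.submatrix (σ⁻¹ : Equiv.Perm _).injective,
    fun q => by rw [coupleHolds_submatrix, hL, mem_permute]⟩

theorem mem_relationOf_Vpd {m : ℕ} {L : CIRelation m} {q : CICouple m} :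
    q ∈ relationOf (Vpd L) ↔ ∀ K, IsRepresentable K → L ⊆ K → q ∈ K := by
  rw [mem_relationOf]
  constructor
  · rintro h K ⟨S, hS, hK⟩ hLK
    exact (hK q).1 (h S ⟨hS, fun p hp => (hK p).2 (hLK hp)⟩)
  · rintro h S ⟨hS, hSL⟩
    have := h _ (isRepresentable_relationOf hS) fun p hp => by
      simpa [mem_relationOf] using hSL p hp
    simpa [mem_relationOf] using this

theorem isCompleteRelation_iff {m : ℕ} {L : CIRelation m} :
    IsCompleteRelation L ↔ ∀ q, (∀ K, IsRepresentable K → L ⊆ K → q ∈ K) → q ∈ L := by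
  simp only [← mem_relationOf_Vpd]
  refine ⟨fun h q hq => h.symm ▸ hq, fun h => Finset.Subset.antisymm (fun q hq => ?_) h⟩
  exact mem_relationOf_Vpd.2 fun K _ hLK => hLK hq

theorem IsRepresentable.isCompleteRelation {m : ℕ} {L : CIRelation m} (h : IsRepresentable L) :
    IsCompleteRelation L :=
  isCompleteRelation_iff.2 fun _ hq => hq L h (Finset.Subset.refl L)

theorem IsCompleteRelation.permute {m : ℕ} {L : CIRelation m} (h : IsCompleteRelation L)
    (σ : Equiv.Perm (Fin m)) : IsCompleteRelation (permute σ L) := by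
  rw [isCompleteRelation_iff] at h ⊢
  intro q hq
  refine mem_permute.2 (h _ fun K hK hLK => ?_)
  exact mem_permute.1 (hq _ (hK.permute σ) (Finset.image_subset_image hLK))

theorem isCompleteRelation_intersection {t : List Component}
    (ht : ∀ r ∈ t, IsRepresentable r.relation) : IsCompleteRelation (intersection t) := by
  refine isCompleteRelation_iff.2 fun q hq => ?_
  simp only [intersection, Finset.mem_filter, Finset.mem_univ, true_and]
  exact fun r hr => hq _ (ht r hr) fun p hp => (Finset.mem_filter.1 hp).2 r hr

theorem mem_removeRepetitions {l : List ℕ} {n : ℕ} : n ∈ removeRepetitions l ↔ n ∈ l := by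
  induction l with
  | nil => rfl
  | cons m l ih =>
    rw [removeRepetitions]
    split_ifs with h
    · rw [ih, List.mem_cons, iff_or_self]
      rintro rfl
      simpa [Nat.beq_eq] using h
    · rw [List.mem_cons, List.mem_cons, ih]

theorem mem_orbits {l : List ℕ} {n : ℕ} : n ∈ orbits l ↔ ∃ m ∈ l, n ∈ orbit m := by
  simp only [orbits, List.mem_flatMap, mem_removeRepetitions]

theorem exists_ciEquivalent_iff {l : List ℕ} {L : CIRelation 4} :
    (∃ K ∈ l.map decode, CIEquivalent K L) ↔ ∃ n ∈ orbits l, decode n = L := by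
  simp only [List.mem_map, exists_exists_and_eq_and, ciEquivalent_decode, mem_orbits]
  exact ⟨fun ⟨m, hm, n, hn, h⟩ => ⟨n, ⟨m, hm, hn⟩, h⟩, fun ⟨n, ⟨m, hm, hn⟩, h⟩ => ⟨m, hm, n, hn, h⟩⟩

theorem isRepresentable_repMasks {n : ℕ} (hn : n ∈ repMasks) : IsRepresentable (decode n) := by
  obtain ⟨i, hi, rfl⟩ := List.mem_iff_getElem.1 hn
  have := isRepresentable_of_represents (represents_witnesses ⟨i, hi⟩)
  rwa [List.getD_eq_getElem _ _ hi] at this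

theorem IsRepresentable.encode_mem {L : CIRelation 4} (h : IsRepresentable L) :
    encode L ∈ orbits repMasks := by
  obtain ⟨S, hS, hL⟩ := h
  refine mem_of_search_nextClosed (encode_lt L) (fun c hc => ?_) search_closed
  by_contra hfalse
  rw [clauseTest, Bool.or_eq_true, not_or, Bool.not_eq_true', Bool.not_eq_true',
    Bool.not_eq_false, Bool.not_eq_false, Nat.beq_eq, Nat.beq_eq] at hfalse
  obtain ⟨h1, h2⟩ := hfalse
  obtain ⟨k, hk, hk'⟩ := isValidClause_allClauses c hc S hS fun k hk => by
    have h1 : encode L &&& c.1 = c.1 := h1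
    rw [hL, ← decide_eq_true_iff (p := couple k ∈ L), ← testBit_encode]
    rw [← h1, Nat.testBit_and, Bool.and_eq_true] at hk
    exact hk.1
  have h2 : encode L &&& c.2 = 0 := h2
  have h3 : (encode L &&& c.2).testBit k = true := by
    rw [Nat.testBit_and, hk, testBit_encode, Bool.and_true, decide_eq_true_iff, ← hL]
    exact hk'
  rw [h2, Nat.zero_testBit] at h3
  exact Bool.noConfusion h3

theorem isRepresentable_iff {L : CIRelation 4} :
    IsRepresentable L ↔ ∃ K ∈ representableTable, CIEquivalent K L := by
  rw [representableTable_eq]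
  constructor
  · exact fun h => exists_ciEquivalent_iff.2 ⟨_, h.encode_mem, decode_encode L⟩
  · rintro ⟨K, hK, σ, rfl⟩
    obtain ⟨n, hn, rfl⟩ := List.mem_map.1 hK
    exact (isRepresentable_repMasks hn).permute σ

theorem IsCompleteRelation.encode_mem {L : CIRelation 4} (h : IsCompleteRelation L) :
    encode L ∈ orbits (repMasks ++ intMasks) := by
  refine mem_of_search_nextIntersection (encode_lt L) (fun j hj hR => ?_) search_intersection
  rw [testBit_encode L ⟨j, hj⟩, decide_eq_true_iff]
  refine isCompleteRelation_iff.1 h _ fun K hK hLK => ?_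
  rw [← decode_encode K, couple_mem_decode]
  refine hR _ hK.encode_mem ((decode_subset_decode (encode_lt L)).1 ?_)
  rwa [decode_encode, decode_encode]

theorem component_relation {t : List Component} (ht : t ∈ completeTable) {r : Component}
    (hr : r ∈ t) : ∃ K, representableTable[r.label - 1]? = some K ∧
      permute r.perm K = r.relation := by
  rw [completeTable_eq] at ht
  obtain ⟨d, hd, rfl⟩ := List.mem_map.1 ht
  obtain ⟨c, hc, rfl⟩ := List.mem_map.1 hr
  obtain ⟨hlt, e, he, he', hact⟩ := componentData_perm d hd c hc
  refine ⟨decode (repMasks.getD (c.2.1 - 1) 0), ?_, ?_⟩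
  · rw [representableTable_eq, List.getElem?_map]
    change Option.map decode repMasks[c.2.1 - 1]? = _
    rw [List.getD_eq_getElem?_getD,
      List.getElem?_eq_getElem (show c.2.1 - 1 < repMasks.length from hlt)]
    rfl
  · change permute (cyc c.2.2) _ = decode c.1
    rw [← he', cyc_eq_permWord e he, permute_permWord, hact]

theorem isRepresentable_component {t : List Component} (ht : t ∈ completeTable) {r : Component}
    (hr : r ∈ t) : IsRepresentable r.relation := by
  obtain ⟨K, hK, h⟩ := component_relation ht hr
  rw [← h]
  exact IsRepresentable.permute (isRepresentable_iff.2
    ⟨K, List.mem_of_getElem? hK, 1, permute_one K⟩) _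

theorem intersection_map_toComponent (t : List (ℕ × ℕ × List (List ℕ))) :
    intersection (t.map toComponent) = decode (intersectionMask t) := by
  refine relation_ext fun k => ?_
  have h1 : (16777215 : ℕ).testBit k = true := by
    rw [show 16777215 = 2 ^ 24 - 1 by rfl, Nat.testBit_two_pow_sub_one, decide_eq_true k.2]
  rw [couple_mem_decode, intersectionMask, testBit_foldl_land]
  simp only [intersection, Finset.mem_filter, Finset.mem_univ, true_and, List.forall_mem_map,
    toComponent, couple_mem_decode, h1]

theorem completeTable_map_intersection : completeTable.map intersection = intMasks.map decode := by
  rw [completeTable_eq, intMasks_eq, List.map_map, List.map_map]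
  exact List.map_congr_left fun t _ => intersection_map_toComponent t

theorem pairwise_not_ciEquivalent :
    (representableTable ++ completeTable.map intersection).Pairwise
      fun K L => ¬ CIEquivalent K L := by
  rw [representableTable_eq, completeTable_map_intersection, ← List.map_append, List.pairwise_map]
  refine pairwise_orbit.imp_of_mem fun {m n} hm hn h => ?_
  rw [ciEquivalent_decode_decode (masks_lt m hm) (masks_lt n hn)]
  intro hmn
  rw [List.any_eq_false] at h
  exact h n hmn (by rw [Nat.beq_eq])

theorem isCompleteRelation_iff_table {L : CIRelation 4} : IsCompleteRelation L ↔
    ∃ K ∈ representableTable ++ completeTable.map intersection, CIEquivalent K L := by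
  constructor
  · intro h
    rw [representableTable_eq, completeTable_map_intersection, ← List.map_append]
    exact exists_ciEquivalent_iff.2 ⟨_, h.encode_mem, decode_encode L⟩
  · rintro ⟨K, hK, σ, rfl⟩
    refine IsCompleteRelation.permute ?_ σ
    rcases List.mem_append.1 hK with hK | hK
    · exact (isRepresentable_iff.2 ⟨K, hK, 1, permute_one K⟩).isCompleteRelation
    · obtain ⟨t, ht, rfl⟩ := List.mem_map.1 hK
      exact isCompleteRelation_intersection fun r hr => isRepresentable_component ht hr

theorem isCompleteRelation_and_not_isRepresentable_iff {L : CIRelation 4} :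
    IsCompleteRelation L ∧ ¬ IsRepresentable L ↔
      ∃ K ∈ completeTable.map intersection, CIEquivalent K L := by
  rw [isCompleteRelation_iff_table, isRepresentable_iff]
  constructor
  · rintro ⟨⟨K, hK, hKL⟩, h⟩
    rcases List.mem_append.1 hK with hK | hK
    · exact absurd ⟨K, hK, hKL⟩ h
    · exact ⟨K, hK, hKL⟩
  · rintro ⟨K, hK, hKL⟩
    refine ⟨⟨K, List.mem_append_right _ hK, hKL⟩, ?_⟩
    rintro ⟨K', hK', hKL'⟩
    exact (List.pairwise_append.1 pairwise_not_ciEquivalent).2.2 K' hK' K hK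
      ((ciSetoid 4).trans hKL' ((ciSetoid 4).symm hKL))

theorem numClasses_eq_length {m : ℕ} {P : CIRelation m → Prop} {l : List (CIRelation m)}
    (hl : l.Pairwise fun K L => ¬ CIEquivalent K L)
    (h : ∀ L, P L ↔ ∃ K ∈ l, CIEquivalent K L) : numClasses m P = l.length := by
  classical
  have hnodup : (l.map (Quotient.mk (ciSetoid m))).Nodup := by
    rw [List.Nodup, List.pairwise_map]
    exact hl.imp fun hKL heq => hKL (Quotient.exact heq)
  have : {c : Quotient (ciSetoid m) | ∃ L, P L ∧ Quotient.mk (ciSetoid m) L = c} =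
      ((l.map (Quotient.mk (ciSetoid m))).toFinset : Set _) := by
    ext c
    simp only [Set.mem_ofPred_eq, List.coe_toFinset, List.mem_map]
    constructor
    · rintro ⟨L, hL, rfl⟩
      obtain ⟨K, hK, hKL⟩ := (h L).1 hL
      exact ⟨K, hK, Quotient.sound hKL⟩
    · rintro ⟨K, hK, rfl⟩
      exact ⟨K, (h K).2 ⟨K, hK, (ciSetoid m).refl K⟩, rfl⟩
  rw [numClasses, this, Set.ncard_coe_finset, List.toFinset_card_of_nodup hnodup, List.length_map]

theorem isMinimalRepresentableDecomposition_table {t : List Component} (ht : t ∈ completeTable) :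
    IsMinimalRepresentableDecomposition (intersection t) (t.map Component.relation) := by
  refine ⟨?_, ?_, ?_⟩
  · intro K hK
    obtain ⟨r, hr, rfl⟩ := List.mem_map.1 hK
    exact isRepresentable_component ht hr
  · ext S
    simp only [Set.mem_iUnion, List.mem_map, exists_prop, exists_exists_and_eq_and]
    constructor
    · rintro ⟨hS, hSt⟩
      rw [completeTable_eq] at ht
      obtain ⟨d, hd, rfl⟩ := List.mem_map.1 ht
      have hcover := List.all_eq_true.1 (componentData_cover d hd) _
        (isRepresentable_relationOf hS).encode_mem
      have hsub : intersection (d.map toComponent) ⊆ relationOf {S} := fun q hq => by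
        simpa [mem_relationOf] using hSt q hq
      rw [intersection_map_toComponent, ← decode_encode (relationOf {S}),
        decode_subset_decode (lt_of_le_of_lt ?_ (by norm_num : 16777215 < 2 ^ 24))] at hsub
      · change Nat.land _ _ = _ at hsub
        rw [hsub, Nat.beq_refl, Bool.not_true, Bool.false_or, List.any_eq_true] at hcover
        obtain ⟨c, hc, hc'⟩ := hcover
        have hc' := (decode_subset_decode (componentData_lt d hd c hc)).2
          (Nat.eq_of_beq_eq_true hc')
        rw [decode_encode] at hc'
        refine ⟨toComponent c, List.mem_map_of_mem hc, hS, fun q hq => ?_⟩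
        simpa [mem_relationOf] using hc' hq
      · refine Nat.le_of_lt_succ (Nat.lt_pow_two_of_testBit (n := 24) _ fun i hi => ?_)
        by_contra hbit
        rw [Bool.not_eq_false, intersectionMask, testBit_foldl_land] at hbit
        rw [Nat.testBit_eq_false_of_lt ((by norm_num : 16777215 < 2 ^ 24).trans_le
          (Nat.pow_le_pow_right (by norm_num) hi))] at hbit
        exact Bool.noConfusion hbit.1
    · rintro ⟨r, hr, hS, hSr⟩
      exact ⟨hS, fun q hq => hSr q ((Finset.mem_filter.1 hq).2 r hr)⟩
  · rw [completeTable_eq] at ht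
    obtain ⟨d, hd, rfl⟩ := List.mem_map.1 ht
    rw [List.map_map, List.pairwise_map]
    refine (componentData_pairwise d hd).imp_of_mem fun {a b} ha hb h => ?_
    change ¬ decode a.1 ⊆ decode b.1 ∧ ¬ decode b.1 ⊆ decode a.1
    rwa [decode_subset_decode (componentData_lt d hd a ha),
      decode_subset_decode (componentData_lt d hd b hb)]

theorem mainTheorem2 :
    -- The numbers of equivalence classes.
    numClasses 4 IsCompleteRelation = 101 ∧
    numClasses 4 IsRepresentable = 53 ∧
    numClasses 4 (fun L => IsCompleteRelation L ∧ ¬ IsRepresentable L) = 48 ∧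
    -- Every representable relation is complete.
    (∀ L : CIRelation 4, IsRepresentable L → IsCompleteRelation L) ∧
    -- The first table lists the representable relations, once per class.
    representableTable.length = 53 ∧
    representableTable.Pairwise (fun K L => ¬ CIEquivalent K L) ∧
    (∀ L : CIRelation 4, IsRepresentable L ↔ ∃ K ∈ representableTable, CIEquivalent K L) ∧
    -- The second table lists the other complete relations, once per class.
    completeTable.length = 48 ∧
    completeTable.Pairwise (fun t t' => ¬ CIEquivalent (intersection t) (intersection t')) ∧
    (∀ L : CIRelation 4, (IsCompleteRelation L ∧ ¬ IsRepresentable L) ↔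
      ∃ t ∈ completeTable, CIEquivalent (intersection t) L) ∧
    -- Each entry of the second table is the minimal representable decomposition of the relation.
    (∀ t ∈ completeTable,
      IsMinimalRepresentableDecomposition (intersection t) (t.map Component.relation)) ∧
    -- Each component is the permuted relation of the first table that is named with it.
    (∀ t ∈ completeTable, ∀ r ∈ t, ∃ K,
      representableTable[r.label - 1]? = some K ∧ permute r.perm K = r.relation) := by
  have hpair := List.pairwise_append.1 pairwise_not_ciEquivalent
  have hlen1 : representableTable.length = 53 := rfl
  have hlen2 : completeTable.length = 48 := rfl
  refine ⟨?_, ?_, ?_, fun L h => h.isCompleteRelation, hlen1, hpair.1,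
    fun L => isRepresentable_iff, hlen2, List.pairwise_map.1 hpair.2.1, fun L => ?_,
    fun t ht => isMinimalRepresentableDecomposition_table ht,
    fun t ht r hr => component_relation ht hr⟩
  · rw [numClasses_eq_length pairwise_not_ciEquivalent fun L => isCompleteRelation_iff_table,
      List.length_append, List.length_map, hlen1, hlen2]
  · rw [numClasses_eq_length hpair.1 fun L => isRepresentable_iff, hlen1]
  · rw [numClasses_eq_length hpair.2.1 fun L => isCompleteRelation_and_not_isRepresentable_iff,
      List.length_map, hlen2]
  · rw [isCompleteRelation_and_not_isRepresentable_iff]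
    simp only [List.mem_map, exists_exists_and_eq_and]
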